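/- Let $\Lambda_2$ be the directed graph with vertices $v_1,v_2$ and exactly one edge between every ordered pair of vertices. A finite path of length $n\ge 0$ is identified with its string of vertices $(v_0,\dots,v_n)$, $\circ$ is the empty path, $F_\circ$ is the set of all finite paths including $\circ$, and $\partial\mathcal B_2$ is the space of infinite paths (sequences of vertices). For $\gamma\in F_\circ$ let $[\gamma]\subseteq\partial\mathcal B_2$ be the set of infinite paths with initial segment $\gamma$, and let $\gamma e$ denote the extension of $\gamma$ by one more vertex $e$. Fix $0<r<1$ and $s\in\mathbb R$. Put $w(v_1)=r$, $w(v_2)=1-r$, $w(\circ)=1$, $w(v_0,\dots,v_n)=\prod_{i=0}^n w(v_i)$, and let $d_w(x,y)=w(x\wedge y)$ for $x\ne y$, where $x\wedge y$ is the longest common initial segment, and $d_w(x,x)=0$. Let $\mu$ be the Markov probability measure on $\partial\mathcal B_2$ with $\mu[\gamma]=w(\gamma)$ for all $\gamma$. A choice function is a map $\tau=(\tau_+,\tau_-):F_\circ\to\partial\mathcal B_2\times\partial\mathcal B_2$ with $\tau_\pm(\gamma)\in[\gamma]$ and $d_w(\tau_+(\gamma),\tau_-(\gamma))=w(\gamma)$.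 On $\ell^2(F_\circ)\otimes\mathbb C^2$ put $$\slashed D=\bigoplus_{\gamma\in F_\circ}\frac1{w(\gamma)}\begin{pmatrix}0&1\\1&0\end{pmatrix},\qquad \pi_\tau(f)=\bigoplus_{\gamma\in F_\circ}\begin{pmatrix}f(\tau_+(\gamma))&0\\0&f(\tau_-(\gamma))\end{pmatrix}.$$ Let $Q_s$ be the form $$Q_s(f,g)=\tfrac12\int \operatorname{Tr}\bigl(|\slashed D|^{-s}[\slashed D,\pi_\tau(f)]^*[\slashed D,\pi_\tau(g)]\bigr)\,d\mu(\tau),\qquad f,g\in\operatorname{Dom}Q_s=\operatorname{span}\{\chi_{[\gamma]}\},$$ where $d\mu(\tau)$ is the product over $\gamma\in F_\circ$ of the normalized restrictions of $\mu\times\mu$ to the set of admissible values of $\tau(\gamma)$, and let $\Delta_s^r$ be the Laplace--Beltrami operator, i.e. the non-positive operator on $L^2(\partial\mathcal B_2,\mu)$ associated with the closure of $Q_s$: $\langle f,\Delta_s^r g\rangle=-Q_s(f,g)$. For $\xi\in F_\circ$ let $$G_s(\xi)=\tfrac12\,w(\xi)^{2-s}\sum_{e\ne e'}\mu[\xi e]\,\mu[\xi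 e'],\qquad E_\xi^r=\operatorname{span}\Bigl\{\frac{\chi_{[\xi e]}}{\mu[\xi e]}-\frac{\chi_{[\xi e']}}{\mu[\xi e']}:e\ne e'\Bigr\}.$$ Then the following hold. (1) $\mu$ is the measure induced by the Dixmier trace: for every choice function $\tau$ and every $\gamma\in F_\circ$, $\displaystyle\mu[\gamma]=\lim_{t\downarrow1}\frac{\operatorname{Tr}(|\slashed D|^{-t}\pi_\tau(\chi_{[\gamma]}))}{\operatorname{Tr}(|\slashed D|^{-t})}$. (2) $G_s(\xi)=\mu[\xi]^{4-s}\,r(1-r)$ for every $\xi\in F_\circ$. (3) Let $\eta=(v_0,\dots,v_n)$, $n\ge0$, be a finite path, $\eta[0,k]=(v_0,\dots,v_k)$ and $\eta[0,-1]=\circ$. Then $E_\eta^r\neq 0$ is contained in the domain of $\Delta_s^r$ and consists of eigenvectors (together with $0$) of $\Delta_s^r$ with eigenvalue $$\lambda_\eta^r=\frac{w(v_0)-1}{r(1-r)}+\sum_{k=0}^{n-1}\frac{\mu[v_0\dots v_k]^{s-3}}{r(1-r)}\bigl(w(v_{k+1})-1\bigr)-\frac{\mu[\eta]^{s-3}}{r(1-r)},$$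 and $$\lambda_\eta^r=\sum_{k=-1}^{n-1}\frac{\mu[\eta[0,k+1]]-\mu[\eta[0,k]]}{G_s(\eta[0,k])}-\frac{\mu[\eta]}{G_s(\eta)}.$$ -/

import Mathlib

open MeasureTheory Filter Topology ProbabilityTheory

noncomputable section

namespace CuntzLaplacian

/-- A vector `(r_1, …, r_D)` of positive vertex weights with sum `1`. -/
structure VertexWeights (D : ℕ) where
  /-- the weight of a vertex -/
  r : Fin D → ℝ
  pos : ∀ i, 0 < r i
  sum_eq_one : ∑ i, r i = 1

/-- The weights `r`, `1 - r` on two vertices. -/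
def twoVertexWeights (r : ℝ) (hr : r ∈ Set.Ioo (0 : ℝ) 1) : VertexWeights 2 where
  r := ![r, 1 - r]
  pos := by
    intro i
    fin_cases i
    · simpa using hr.1
    · simpa using hr.2
  sum_eq_one := by simp

/-- Finite paths (including the empty path `∘ = []`) of the Bratteli diagram of the graph with
`D` vertices and exactly one edge between any ordered pair of vertices. Such a path of length `n`
is the same thing as its string `v_0 … v_n` of `n + 1` vertices. -/
abbrev FinPath (D : ℕ) : Type := List (Fin D)

/-- Infinite paths, as sequences of vertices. -/
abbrev InfPath (D : ℕ) : Type := ℕ → Fin D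

variable {D : ℕ}

/-- The initial segment of `x` consisting of its first `n` vertices. -/
def initialSegment (x : InfPath D) (n : ℕ) : FinPath D := List.ofFn fun i : Fin n => x i

/-- The cylinder set `[γ]`: all infinite paths with initial segment `γ`. -/
def cylinderSet (γ : FinPath D) : Set (InfPath D) := {x | initialSegment x γ.length = γ}

/-- The weight of a finite path is the product of the weights of its vertices; `w(∘) = 1`. -/
def weight (W : VertexWeights D) (γ : FinPath D) : ℝ := (γ.map W.r).prod

/-- The ultrametric `d_w(x, y) = w(x ∧ y)` for `x ≠ y`, where `x ∧ y` is the longest common initial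
segment (`PiNat.firstDiff x y` is the first index at which `x` and `y` differ). -/
def pathDist (W : VertexWeights D) (x y : InfPath D) : ℝ :=
  open Classical in if x = y then 0 else weight W (initialSegment x (PiNat.firstDiff x y))

/-- The pairs which a choice function may take as its value at `γ`: both points are in `[γ]`, and
their distance is the diameter `w(γ)` of `[γ]`. -/
def choicePairs (W : VertexWeights D) (γ : FinPath D) : Set (InfPath D × InfPath D) :=
  {p | p.1 ∈ cylinderSet γ ∧ p.2 ∈ cylinderSet γ ∧ pathDist W p.1 p.2 = weight W γ}

/-- `τ = (τ₊, τ₋)` is a choice function. -/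
def IsChoiceFunction (W : VertexWeights D) (τ : FinPath D → InfPath D × InfPath D) : Prop :=
  ∀ γ, τ γ ∈ choicePairs W γ

/-- The probability measure on the vertices given by the weights. -/
def vertexLaw (W : VertexWeights D) : Measure (Fin D) :=
  ∑ i, ENNReal.ofReal (W.r i) • Measure.dirac i

instance (W : VertexWeights D) : IsProbabilityMeasure (vertexLaw W) := by
  constructor
  simp only [vertexLaw, Measure.coe_finsetSum, Finset.sum_apply, Measure.smul_apply,
    measure_univ, smul_eq_mul, mul_one]
  rw [← ENNReal.ofReal_sum_of_nonneg fun i _ => (W.pos i).le, W.sum_eq_one, ENNReal.ofReal_one]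

/-- The Markov measure `μ` on the infinite path space, `μ[v_0 … v_n] = r_{v_0} ⋯ r_{v_n}`. -/
def pathMeasure (W : VertexWeights D) : Measure (InfPath D) :=
  Measure.infinitePi fun _ : ℕ => vertexLaw W

instance (W : VertexWeights D) : IsProbabilityMeasure (pathMeasure W) := by
  unfold pathMeasure; infer_instance

theorem mem_cylinder_iff (γ : FinPath D) (x : InfPath D) :
    x ∈ cylinderSet γ ↔ ∀ i : Fin γ.length, x i = γ.get i := by
  unfold cylinderSet initialSegment
  constructor
  · intro h i
    have h2 := h
    simp only [Set.mem_ofPred_eq] at h2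
    have h3 := List.ext_getElem_iff.1 h2
    have := h3.2 i (by simp) i.2
    simpa using this
  · intro h
    refine List.ext_getElem (by simp) fun i h1 h2 => ?_
    simpa using h ⟨i, h2⟩

theorem measurableSet_cylinder (γ : FinPath D) : MeasurableSet (cylinderSet γ) := by
  have : cylinderSet γ = ⋂ i : Fin γ.length, (fun x : InfPath D => x i) ⁻¹' {γ.get i} := by
    ext x
    simp [mem_cylinder_iff]
  rw [this]
  exact MeasurableSet.iInter fun i => (measurable_pi_apply _) (measurableSet_singleton _)

theorem weight_pos (W : VertexWeights D) (γ : FinPath D) : 0 < weight W γ := by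
  unfold weight
  induction γ with
  | nil => simp
  | cons a l ih => simpa using mul_pos (W.pos a) ih

theorem vertexLaw_singleton (W : VertexWeights D) (i : Fin D) :
    vertexLaw W {i} = ENNReal.ofReal (W.r i) := by
  classical
  simp [vertexLaw, Set.indicator_apply, Finset.sum_ite_eq']

theorem pathMeasure_cylinder_ne_zero (W : VertexWeights D) (γ : FinPath D) :
    pathMeasure W (cylinderSet γ) ≠ 0 := by
  classical
  by_cases hγ : γ = []
  · subst hγ
    have : cylinderSet ([] : FinPath D) = Set.univ := by
      ext x; simp [cylinderSet, initialSegment]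
    rw [this]; simp
  have hlen : 0 < γ.length := List.length_pos_iff.2 hγ
  have : cylinderSet γ = Set.pi (Finset.range γ.length : Finset ℕ)
      (fun i => {γ.getD i (γ.get ⟨0, hlen⟩)}) := by
    ext x
    rw [mem_cylinder_iff]
    simp only [Finset.coe_range, Set.mem_pi, Set.mem_Iio, Set.mem_singleton_iff]
    constructor
    · intro h i hi
      rw [List.getD_eq_getElem _ _ hi]
      exact h ⟨i, hi⟩
    · intro h i
      have := h i i.2
      rwa [List.getD_eq_getElem _ _ i.2] at this
  rw [this, pathMeasure, Measure.infinitePi_pi _ (fun i _ => measurableSet_singleton _)]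
  refine Finset.prod_ne_zero_iff.2 fun i _ => ?_
  rw [vertexLaw_singleton]
  simpa using W.pos _

theorem choicePairs_measure_ne_zero [Nontrivial (Fin D)] (W : VertexWeights D) (γ : FinPath D) :
    ((pathMeasure W).prod (pathMeasure W)) (choicePairs W γ) ≠ 0 := by
  obtain ⟨e, e', hne⟩ := exists_pair_ne (Fin D)
  have hsub : cylinderSet (γ ++ [e]) ×ˢ cylinderSet (γ ++ [e']) ⊆ choicePairs W γ := by
    rintro ⟨x, y⟩ ⟨hx, hy⟩
    rw [mem_cylinder_iff] at hx hy
    have hx1 : ∀ i (hi : i < γ.length), x i = γ[i] := fun i hi => by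
      have := hx ⟨i, by simp; omega⟩
      simpa [List.getElem_append_left hi] using this
    have hy1 : ∀ i (hi : i < γ.length), y i = γ[i] := fun i hi => by
      have := hy ⟨i, by simp; omega⟩
      simpa [List.getElem_append_left hi] using this
    have hx2 : x γ.length = e := by simpa using hx ⟨γ.length, by simp⟩
    have hy2 : y γ.length = e' := by simpa using hy ⟨γ.length, by simp⟩
    have hxy : x ≠ y := fun h => hne (by rw [← hx2, ← hy2, h])
    have hfd : PiNat.firstDiff x y = γ.length := by
      apply le_antisymm
      · by_contra! hlt
        exact hne (by rw [← hx2, ← hy2]; exact PiNat.apply_eq_of_lt_firstDiff hlt)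
      · by_contra! hlt
        exact PiNat.apply_firstDiff_ne hxy (by rw [hx1 _ hlt, hy1 _ hlt])
    have hxm : x ∈ cylinderSet γ := (mem_cylinder_iff _ _).2 fun i => hx1 i i.2
    have hym : y ∈ cylinderSet γ := (mem_cylinder_iff _ _).2 fun i => hy1 i i.2
    refine ⟨hxm, hym, ?_⟩
    simp only [pathDist, if_neg hxy, hfd]
    rw [hxm]
  intro h0
  have := measure_mono_null hsub h0
  rw [Measure.prod_prod, mul_eq_zero] at this
  rcases this with h | h
  · exact pathMeasure_cylinder_ne_zero W _ h
  · exact pathMeasure_cylinder_ne_zero W _ h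

/-- The normalized restriction of `μ × μ` to the admissible pairs at `γ`. -/
def choicePairMeasure (W : VertexWeights D) (γ : FinPath D) : Measure (InfPath D × InfPath D) :=
  ((pathMeasure W).prod (pathMeasure W))[|choicePairs W γ]

instance [Nontrivial (Fin D)] (W : VertexWeights D) (γ : FinPath D) :
    IsProbabilityMeasure (choicePairMeasure W γ) :=
  cond_isProbabilityMeasure (choicePairs_measure_ne_zero W γ)

/-- The probability measure induced by `μ` on the set of choice functions: the product over all
finite paths `γ` of the normalized restrictions of `μ × μ` to the admissible pairs at `γ`. -/
def choiceMeasure [Nontrivial (Fin D)] (W : VertexWeights D) :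
    Measure (FinPath D → InfPath D × InfPath D) :=
  Measure.infinitePi fun γ => choicePairMeasure W γ

/-! Operators on `ℓ²(finite paths) ⊗ ℂ²` which are direct sums of `2 × 2` blocks, one for each
finite path, are given by the family of their blocks. -/

/-- The Dirac operator, with block `w(γ)⁻¹ (0 1; 1 0)` at `γ`. -/
def dirac (W : VertexWeights D) (γ : FinPath D) : Matrix (Fin 2) (Fin 2) ℂ :=
  ((weight W γ)⁻¹ : ℂ) • !![0, 1; 1, 0]

/-- `|Dirac|^(-s)`, with block `w(γ)^s · 1` at `γ`; indeed the Dirac blocks are Hermitian with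
square `w(γ)⁻² · 1` (see `dirac_mul_self`), so that `|Dirac|` has the blocks `w(γ)⁻¹ · 1`. -/
def absDiracPow (W : VertexWeights D) (s : ℝ) (γ : FinPath D) : Matrix (Fin 2) (Fin 2) ℂ :=
  ((weight W γ ^ s : ℝ) : ℂ) • 1

theorem dirac_mul_self (W : VertexWeights D) (γ : FinPath D) :
    (dirac W γ).IsHermitian ∧ dirac W γ * dirac W γ = (((weight W γ)⁻¹ : ℂ) ^ 2) • 1 := by
  constructor
  · ext i j
    fin_cases i <;> fin_cases j <;> simp [dirac]
  · ext i j
    fin_cases i <;> fin_cases j <;> simp [dirac, sq]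

/-- The representation `π_τ(f)`, with block `diag(f(τ₊(γ)), f(τ₋(γ)))` at `γ`. -/
def pathRepr (τ : FinPath D → InfPath D × InfPath D) (f : InfPath D → ℂ) (γ : FinPath D) :
    Matrix (Fin 2) (Fin 2) ℂ :=
  !![f (τ γ).1, 0; 0, f (τ γ).2]

/-- The commutator `[Dirac, π_τ(f)]`. -/
def diracCommutator (W : VertexWeights D) (τ : FinPath D → InfPath D × InfPath D)
    (f : InfPath D → ℂ) (γ : FinPath D) : Matrix (Fin 2) (Fin 2) ℂ :=
  dirac W γ * pathRepr τ f γ - pathRepr τ f γ * dirac W γ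

/-- The trace of a direct sum of `2 × 2` blocks. -/
def blockTrace (M : FinPath D → Matrix (Fin 2) (Fin 2) ℂ) : ℂ := ∑' γ, (M γ).trace

/-- `ν` is the measure induced by the Dixmier trace (the `ζ`-function has abscissa of
convergence `1`): for every choice function `τ` and every cylinder set `[γ]`,
`ν[γ] = lim_{t ↓ 1} Tr(|Dirac|^(-t) π_τ(χ_[γ])) / Tr(|Dirac|^(-t))`. -/
def IsDixmierMeasure (W : VertexWeights D) (ν : Measure (InfPath D)) : Prop :=
  ∀ τ, IsChoiceFunction W τ → ∀ γ : FinPath D,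
    Tendsto (fun t : ℝ =>
      blockTrace (fun η => absDiracPow W t η * pathRepr τ ((cylinderSet γ).indicator 1) η) /
        blockTrace (absDiracPow W t)) (𝓝[>] 1) (𝓝 ((ν.real (cylinderSet γ) : ℝ) : ℂ))

/-- The Dirichlet form
`Q_s(f, g) = ½ ∫ Tr(|Dirac|^(-s) [Dirac, π_τ(f)]^* [Dirac, π_τ(g)]) dμ(τ)`. -/
def dirichletForm [Nontrivial (Fin D)] (W : VertexWeights D) (s : ℝ) (f g : InfPath D → ℂ) : ℂ :=
  (1 / 2) * ∫ τ, blockTrace (fun γ => absDiracPow W s γ *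
    (diracCommutator W τ f γ).conjTranspose * diracCommutator W τ g γ) ∂(choiceMeasure W)

/-- The domain of the form: the span of the characteristic functions of cylinder sets. -/
def formDomain (D : ℕ) : Submodule ℂ (InfPath D → ℂ) :=
  Submodule.span ℂ (Set.range fun γ : FinPath D => (cylinderSet γ).indicator (1 : InfPath D → ℂ))

/-- The complex Hilbert space `L²` of the infinite path space. -/
abbrev PathL2 (W : VertexWeights D) := Lp ℂ 2 (pathMeasure W)

theorem formDomain_props {f : InfPath D → ℂ} (hf : f ∈ formDomain D) :
    Measurable f ∧ (∃ C : ℝ, ∀ x, ‖f x‖ ≤ C) ∧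
      ∃ N : ℕ, ∀ x y : InfPath D, (∀ i < N, x i = y i) → f x = f y := by
  refine Submodule.span_induction (p := fun f _ => Measurable f ∧ (∃ C : ℝ, ∀ x, ‖f x‖ ≤ C) ∧
      ∃ N : ℕ, ∀ x y : InfPath D, (∀ i < N, x i = y i) → f x = f y) ?_ ?_ ?_ ?_ hf
  · rintro _ ⟨γ, rfl⟩
    refine ⟨measurable_one.indicator (measurableSet_cylinder γ), ⟨1, fun x => ?_⟩, γ.length,
      fun x y h => ?_⟩
    · by_cases hx : x ∈ cylinderSet γ <;> simp [hx]
    · have : x ∈ cylinderSet γ ↔ y ∈ cylinderSet γ := by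
        rw [mem_cylinder_iff, mem_cylinder_iff]
        exact forall_congr' fun i => by rw [h i i.2]
      by_cases hx : x ∈ cylinderSet γ
      · simp [hx, this.1 hx]
      · have hy : y ∉ cylinderSet γ := fun hy => hx (this.2 hy)
        simp [hx, hy]
  · exact ⟨measurable_zero, ⟨0, by simp⟩, 0, by simp⟩
  · rintro f g - - ⟨hf, ⟨C, hC⟩, N, hN⟩ ⟨hg, ⟨C', hC'⟩, N', hN'⟩
    refine ⟨hf.add hg, ⟨C + C', fun x => (norm_add_le _ _).trans (add_le_add (hC x) (hC' x))⟩,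
      max N N', fun x y h => ?_⟩
    simp only [Pi.add_apply]
    rw [hN x y fun i hi => h i (hi.trans_le (le_max_left _ _)),
      hN' x y fun i hi => h i (hi.trans_le (le_max_right _ _))]
  · rintro c f - ⟨hf, ⟨C, hC⟩, N, hN⟩
    refine ⟨hf.const_smul c, ⟨‖c‖ * C, fun x => ?_⟩, N, fun x y h => ?_⟩
    · simpa using mul_le_mul_of_nonneg_left (hC x) (norm_nonneg c)
    · simp [hN x y h]

theorem trace_block (W : VertexWeights D) (s : ℝ) (f g : InfPath D → ℂ)
    (τ : FinPath D → InfPath D × InfPath D) (γ : FinPath D) :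
    (absDiracPow W s γ * (diracCommutator W τ f γ).conjTranspose *
      diracCommutator W τ g γ).trace =
    2 * ((weight W γ ^ (s - 2) : ℝ) : ℂ) *
      (starRingEnd ℂ (f (τ γ).1 - f (τ γ).2) * (g (τ γ).1 - g (τ γ).2)) := by
  have hw := weight_pos W γ
  have hwc : (weight W γ : ℂ) ≠ 0 := by exact_mod_cast hw.ne'
  have h2 : weight W γ ^ (s - 2) = weight W γ ^ s * ((weight W γ)⁻¹ * (weight W γ)⁻¹) := by
    rw [Real.rpow_sub hw, Real.rpow_two, div_eq_mul_inv, sq, mul_inv]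
  rw [h2]
  simp [absDiracPow, diracCommutator, dirac, pathRepr, Matrix.trace, Matrix.mul_apply,
    Fin.sum_univ_two, Matrix.conjTranspose_apply]
  ring

theorem ae_mem_cylinder (W : VertexWeights D) (γ : FinPath D) :
    ∀ᵐ p ∂(choicePairMeasure W γ), p.1 ∈ cylinderSet γ ∧ p.2 ∈ cylinderSet γ := by
  have hm : MeasurableSet {p : InfPath D × InfPath D | p.1 ∈ cylinderSet γ ∧ p.2 ∈ cylinderSet γ} :=
    (measurableSet_cylinder γ).prod (measurableSet_cylinder γ)
  rw [choicePairMeasure, ProbabilityTheory.cond]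
  refine Measure.ae_smul_measure ?_ _
  rw [ae_restrict_iff hm]
  exact Eventually.of_forall fun p hp => ⟨hp.1, hp.2.1⟩

theorem integrable_pairing [Nontrivial (Fin D)] (W : VertexWeights D) (γ : FinPath D)
    {f g : InfPath D → ℂ} (hf : f ∈ formDomain D) (hg : g ∈ formDomain D) :
    Integrable (fun p : InfPath D × InfPath D =>
      starRingEnd ℂ (f p.1 - f p.2) * (g p.1 - g p.2)) (choicePairMeasure W γ) := by
  obtain ⟨hfm, ⟨C, hC⟩, -⟩ := formDomain_props hf
  obtain ⟨hgm, ⟨C', hC'⟩, -⟩ := formDomain_props hg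
  have hm : Measurable fun p : InfPath D × InfPath D =>
      starRingEnd ℂ (f p.1 - f p.2) * (g p.1 - g p.2) :=
    (Complex.continuous_conj.measurable.comp
      ((hfm.comp measurable_fst).sub (hfm.comp measurable_snd))).mul
      ((hgm.comp measurable_fst).sub (hgm.comp measurable_snd))
  refine Integrable.of_bound hm.aestronglyMeasurable ((C + C) * (C' + C'))
    (Eventually.of_forall fun p => ?_)
  rw [norm_mul, RCLike.norm_conj]
  have h1 := (norm_sub_le (f p.1) (f p.2)).trans (add_le_add (hC p.1) (hC p.2))
  have h2 := (norm_sub_le (g p.1) (g p.2)).trans (add_le_add (hC' p.1) (hC' p.2))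
  exact mul_le_mul h1 h2 (norm_nonneg _) ((norm_nonneg _).trans h1)

theorem integrable_conj_mul (W : VertexWeights D) {f : InfPath D → ℂ} (hf : f ∈ formDomain D)
    (H : PathL2 W) :
    Integrable (fun x => starRingEnd ℂ (f x) * H x) (pathMeasure W) := by
  obtain ⟨hfm, ⟨C, hC⟩, -⟩ := formDomain_props hf
  refine Integrable.bdd_mul (c := C) ((Lp.memLp H).integrable one_le_two)
    (Complex.continuous_conj.measurable.comp hfm).aestronglyMeasurable
    (Eventually.of_forall fun x => ?_)
  simpa using hC x

/-- On the domain, the form is a finite sum of integrals over the admissible pairs. -/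
theorem dirichletForm_eq [Nontrivial (Fin D)] (W : VertexWeights D) (s : ℝ)
    {g : InfPath D → ℂ} {N : ℕ}
    (hN : ∀ x y : InfPath D, (∀ i < N, x i = y i) → g x = g y) (hg : g ∈ formDomain D)
    {f : InfPath D → ℂ} (hf : f ∈ formDomain D) :
    dirichletForm W s f g =
      ∑ γ ∈ (List.finite_length_lt (Fin D) N).toFinset, ((weight W γ ^ (s - 2) : ℝ) : ℂ) *
        ∫ p, starRingEnd ℂ (f p.1 - f p.2) * (g p.1 - g p.2) ∂(choicePairMeasure W γ) := by
  have hgp := formDomain_props hg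
  have hfp := formDomain_props hf
  have hint : ∀ γ, Integrable (fun p : InfPath D × InfPath D =>
      starRingEnd ℂ (f p.1 - f p.2) * (g p.1 - g p.2)) (choicePairMeasure W γ) :=
    fun γ => integrable_pairing W γ hf hg
  have hae : ∀ᵐ τ ∂(choiceMeasure W), ∀ γ : FinPath D,
      (τ γ).1 ∈ cylinderSet γ ∧ (τ γ).2 ∈ cylinderSet γ := by
    rw [ae_all_iff]
    intro γ
    exact (measurePreserving_eval_infinitePi (fun γ => choicePairMeasure W γ)
      γ).quasiMeasurePreserving.ae (ae_mem_cylinder W γ)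
  have hfin : ∀ᵐ τ ∂(choiceMeasure W), blockTrace (fun γ => absDiracPow W s γ *
      (diracCommutator W τ f γ).conjTranspose * diracCommutator W τ g γ) =
      ∑ γ ∈ (List.finite_length_lt (Fin D) N).toFinset,
        2 * ((weight W γ ^ (s - 2) : ℝ) : ℂ) *
        (starRingEnd ℂ (f (τ γ).1 - f (τ γ).2) * (g (τ γ).1 - g (τ γ).2)) := by
    filter_upwards [hae] with τ hτ
    rw [blockTrace, tsum_eq_sum (s := (List.finite_length_lt (Fin D) N).toFinset)]
    · exact Finset.sum_congr rfl fun γ _ => trace_block W s f g τ γ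
    · intro γ hγ
      have hlen : N ≤ γ.length := by simpa using hγ
      have h1 := (mem_cylinder_iff _ _).1 (hτ γ).1
      have h2 := (mem_cylinder_iff _ _).1 (hτ γ).2
      rw [trace_block, hN (τ γ).1 (τ γ).2 fun i hi => ?_]
      · simp
      · rw [h1 ⟨i, hi.trans_le hlen⟩, h2 ⟨i, hi.trans_le hlen⟩]
  have hmp : ∀ γ, MeasurePreserving (Function.eval γ) (choiceMeasure W) (choicePairMeasure W γ) :=
    fun γ => measurePreserving_eval_infinitePi (fun γ => choicePairMeasure W γ) γ
  rw [dirichletForm, integral_congr_ae hfin, integral_finsetSum, Finset.mul_sum]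
  · refine Finset.sum_congr rfl fun γ _ => ?_
    rw [integral_const_mul]
    have h3 : ∫ τ, (starRingEnd ℂ (f (τ γ).1 - f (τ γ).2) * (g (τ γ).1 - g (τ γ).2))
        ∂(choiceMeasure W) = ∫ p, starRingEnd ℂ (f p.1 - f p.2) * (g p.1 - g p.2)
          ∂(choicePairMeasure W γ) := by
      rw [← (hmp γ).map_eq, integral_map (hmp γ).measurable.aemeasurable
        (by rw [(hmp γ).map_eq]; exact (hint γ).aestronglyMeasurable)]
    rw [h3]
    ring
  · intro γ _
    exact Integrable.const_mul ((hmp γ).integrable_comp_of_integrable (hint γ)) _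

/-- The quadratic form, as a real number. -/
theorem dirichletForm_self [Nontrivial (Fin D)] (W : VertexWeights D) (s : ℝ)
    {g : InfPath D → ℂ} {N : ℕ}
    (hN : ∀ x y : InfPath D, (∀ i < N, x i = y i) → g x = g y) (hg : g ∈ formDomain D) :
    dirichletForm W s g g =
      ((∑ γ ∈ (List.finite_length_lt (Fin D) N).toFinset, weight W γ ^ (s - 2) *
        ∫ p, ‖g p.1 - g p.2‖ ^ 2 ∂(choicePairMeasure W γ) : ℝ) : ℂ) := by
  rw [dirichletForm_eq W s hN hg hg]
  push_cast
  refine Finset.sum_congr rfl fun γ _ => ?_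
  congr 1
  refine Eq.trans ?_ integral_ofReal
  refine integral_congr_ae (Eventually.of_forall fun p => ?_)
  simp only [Complex.conj_mul']
  push_cast
  rfl

theorem norm_dirichletForm_add_le [Nontrivial (Fin D)] (W : VertexWeights D) (s : ℝ)
    {f g : InfPath D → ℂ} (hf : f ∈ formDomain D) (hg : g ∈ formDomain D) :
    ‖dirichletForm W s (f + g) (f + g)‖ ≤
      2 * ‖dirichletForm W s f f‖ + 2 * ‖dirichletForm W s g g‖ := by
  obtain ⟨N, hN⟩ := (formDomain_props hf).2.2
  obtain ⟨N', hN'⟩ := (formDomain_props hg).2.2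
  have h1 : ∀ x y : InfPath D, (∀ i < max N N', x i = y i) → f x = f y :=
    fun x y h => hN x y fun i hi => h i (hi.trans_le (le_max_left _ _))
  have h2 : ∀ x y : InfPath D, (∀ i < max N N', x i = y i) → g x = g y :=
    fun x y h => hN' x y fun i hi => h i (hi.trans_le (le_max_right _ _))
  have h3 : ∀ x y : InfPath D, (∀ i < max N N', x i = y i) → (f + g) x = (f + g) y :=
    fun x y h => by simp [h1 x y h, h2 x y h]
  have hnn : ∀ h : InfPath D → ℂ, 0 ≤ ∑ γ ∈ (List.finite_length_lt (Fin D) (max N N')).toFinset,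
      weight W γ ^ (s - 2) * ∫ p, ‖h p.1 - h p.2‖ ^ 2 ∂(choicePairMeasure W γ) :=
    fun h => Finset.sum_nonneg fun γ _ => mul_nonneg (Real.rpow_nonneg (weight_pos W γ).le _)
      (integral_nonneg fun p => by positivity)
  rw [dirichletForm_self W s h1 hf, dirichletForm_self W s h2 hg,
    dirichletForm_self W s h3 (add_mem hf hg), Complex.norm_of_nonneg (hnn _),
    Complex.norm_of_nonneg (hnn _), Complex.norm_of_nonneg (hnn _), Finset.mul_sum, Finset.mul_sum,
    ← Finset.sum_add_distrib]
  have hsq : ∀ {h : InfPath D → ℂ}, h ∈ formDomain D → ∀ γ, Integrable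
      (fun p : InfPath D × InfPath D => ‖h p.1 - h p.2‖ ^ 2) (choicePairMeasure W γ) := by
    intro h hh γ
    refine (integrable_pairing W γ hh hh).norm.congr (Eventually.of_forall fun p => ?_)
    simp only [norm_mul, RCLike.norm_conj, sq]
  refine Finset.sum_le_sum fun γ _ => ?_
  have hle : ∫ p, ‖(f + g) p.1 - (f + g) p.2‖ ^ 2 ∂(choicePairMeasure W γ) ≤
      2 * ∫ p, ‖f p.1 - f p.2‖ ^ 2 ∂(choicePairMeasure W γ) +
      2 * ∫ p, ‖g p.1 - g p.2‖ ^ 2 ∂(choicePairMeasure W γ) := by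
    rw [← integral_const_mul, ← integral_const_mul, ← integral_add ((hsq hf γ).const_mul 2)
      ((hsq hg γ).const_mul 2)]
    refine integral_mono (hsq (add_mem hf hg) γ)
      (((hsq hf γ).const_mul 2).add ((hsq hg γ).const_mul 2)) fun p => ?_
    have e : (f + g) p.1 - (f + g) p.2 = (f p.1 - f p.2) + (g p.1 - g p.2) := by
      simp only [Pi.add_apply]; ring
    have := norm_add_le (f p.1 - f p.2) (g p.1 - g p.2)
    simp only [e]
    nlinarith [norm_nonneg ((f p.1 - f p.2) + (g p.1 - g p.2)), norm_nonneg (f p.1 - f p.2),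
      norm_nonneg (g p.1 - g p.2), sq_nonneg (‖f p.1 - f p.2‖ - ‖g p.1 - g p.2‖)]
  have := mul_le_mul_of_nonneg_left hle (Real.rpow_nonneg (weight_pos W γ).le (s - 2))
  linarith

theorem dirichletForm_add_right [Nontrivial (Fin D)] (W : VertexWeights D) (s : ℝ)
    {f g h : InfPath D → ℂ} (hf : f ∈ formDomain D) (hg : g ∈ formDomain D)
    (hh : h ∈ formDomain D) :
    dirichletForm W s f (g + h) = dirichletForm W s f g + dirichletForm W s f h := by
  obtain ⟨N, hN⟩ := (formDomain_props hg).2.2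
  obtain ⟨N', hN'⟩ := (formDomain_props hh).2.2
  have h1 : ∀ x y : InfPath D, (∀ i < max N N', x i = y i) → g x = g y :=
    fun x y h => hN x y fun i hi => h i (hi.trans_le (le_max_left _ _))
  have h2 : ∀ x y : InfPath D, (∀ i < max N N', x i = y i) → h x = h y :=
    fun x y h => hN' x y fun i hi => h i (hi.trans_le (le_max_right _ _))
  have h3 : ∀ x y : InfPath D, (∀ i < max N N', x i = y i) → (g + h) x = (g + h) y :=
    fun x y h => by simp [h1 x y h, h2 x y h]
  rw [dirichletForm_eq W s h1 hg hf, dirichletForm_eq W s h2 hh hf,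
    dirichletForm_eq W s h3 (add_mem hg hh) hf, ← Finset.sum_add_distrib]
  refine Finset.sum_congr rfl fun γ _ => ?_
  rw [← mul_add, ← integral_add (integrable_pairing W γ hf hg) (integrable_pairing W γ hf hh)]
  refine congrArg (fun z => ((weight W γ ^ (s - 2) : ℝ) : ℂ) * z)
    (integral_congr_ae (Eventually.of_forall fun p => ?_))
  simp only [Pi.add_apply]
  ring

theorem dirichletForm_smul_right [Nontrivial (Fin D)] (W : VertexWeights D) (s : ℝ) (c : ℂ)
    {f g : InfPath D → ℂ} (hf : f ∈ formDomain D) (hg : g ∈ formDomain D) :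
    dirichletForm W s f (c • g) = c * dirichletForm W s f g := by
  obtain ⟨N, hN⟩ := (formDomain_props hg).2.2
  have h3 : ∀ x y : InfPath D, (∀ i < N, x i = y i) → (c • g) x = (c • g) y :=
    fun x y h => by simp [hN x y h]
  rw [dirichletForm_eq W s hN hg hf, dirichletForm_eq W s h3 (Submodule.smul_mem _ c hg) hf,
    Finset.mul_sum]
  refine Finset.sum_congr rfl fun γ _ => ?_
  rw [mul_left_comm, ← integral_const_mul c]
  refine congrArg (fun z => ((weight W γ ^ (s - 2) : ℝ) : ℂ) * z)
    (integral_congr_ae (Eventually.of_forall fun p => ?_))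
  simp only [Pi.smul_apply, smul_eq_mul]
  ring

theorem norm_dirichletForm_smul [Nontrivial (Fin D)] (W : VertexWeights D) (s : ℝ) (c : ℂ)
    {g : InfPath D → ℂ} (hg : g ∈ formDomain D) :
    ‖dirichletForm W s (c • g) (c • g)‖ = ‖c‖ ^ 2 * ‖dirichletForm W s g g‖ := by
  obtain ⟨N, hN⟩ := (formDomain_props hg).2.2
  have h3 : ∀ x y : InfPath D, (∀ i < N, x i = y i) → (c • g) x = (c • g) y :=
    fun x y h => by simp [hN x y h]
  have : dirichletForm W s (c • g) (c • g) = ((‖c‖ ^ 2 : ℝ) : ℂ) * dirichletForm W s g g := by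
    rw [dirichletForm_self W s hN hg, dirichletForm_self W s h3 (Submodule.smul_mem _ c hg),
      ← Complex.ofReal_mul, Finset.mul_sum]
    congr 1
    refine Finset.sum_congr rfl fun γ _ => ?_
    rw [mul_left_comm, ← integral_const_mul (‖c‖ ^ 2)]
    refine congrArg (fun z => weight W γ ^ (s - 2) * z) (integral_congr_ae (Eventually.of_forall fun p => ?_))
    simp only [Pi.smul_apply, smul_eq_mul, ← mul_sub, norm_mul, mul_pow]
  rw [this, norm_mul, Complex.norm_of_nonneg (by positivity)]

/-- The graph of the operator on `L²` that the classical theory of Dirichlet forms associates with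
the closure of `Q_s`, with the sign that makes the operator non-positive. The pair `(G, H)` belongs
to the graph iff `G` is in the domain of the closure of `Q_s` (i.e. `G` is the `L²`-limit of a
`Q_s`-Cauchy sequence `g_n` in the form domain) and `⟨f, H⟩ = -Q_s(f, G)` (where
`Q_s(f, G) = lim Q_s(f, g_n)`) for all `f` in the form domain. -/
def laplaceGraph [Nontrivial (Fin D)] (W : VertexWeights D) (s : ℝ) :
    Submodule ℂ (PathL2 W × PathL2 W) where
  carrier := {P | ∃ g : ℕ → InfPath D → ℂ,
    (∀ n, g n ∈ formDomain D) ∧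
    Tendsto (fun n => eLpNorm (g n - ⇑P.1) 2 (pathMeasure W)) atTop (𝓝 0) ∧
    Tendsto (fun k : ℕ × ℕ => dirichletForm W s (g k.1 - g k.2) (g k.1 - g k.2)) atTop (𝓝 0) ∧
    ∀ f ∈ formDomain D, Tendsto (fun n => dirichletForm W s f (g n)) atTop
      (𝓝 (-∫ x, starRingEnd ℂ (f x) * P.2 x ∂(pathMeasure W)))}
  zero_mem' := by
    refine ⟨fun _ => 0, fun _ => zero_mem _, ?_, ?_, fun f hf => ?_⟩
    · have : eLpNorm (0 - ⇑(0 : PathL2 W)) 2 (pathMeasure W) = 0 := by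
        rw [eLpNorm_congr_ae (g := (0 : InfPath D → ℂ)), eLpNorm_zero]
        filter_upwards [Lp.coeFn_zero ℂ 2 (pathMeasure W)] with x hx
        simp
      simp only [Prod.fst_zero, this, tendsto_const_nhds_iff]
    · have := norm_dirichletForm_smul W s 0 (zero_mem (formDomain D))
      have h0 : dirichletForm W s (0 - 0) (0 - 0) = 0 := by simpa using this
      simp only [h0, tendsto_const_nhds_iff]
    · have h0 : dirichletForm W s f 0 = 0 := by
        simpa using dirichletForm_smul_right W s 0 hf (zero_mem (formDomain D))
      have h1 : ∫ x, starRingEnd ℂ (f x) * (0 : PathL2 W) x ∂(pathMeasure W) = 0 := by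
        rw [integral_congr_ae (g := fun _ => (0 : ℂ)), integral_zero]
        filter_upwards [Lp.coeFn_zero ℂ 2 (pathMeasure W)] with x hx
        simp
      simp only [h0, Prod.snd_zero, h1, neg_zero, tendsto_const_nhds_iff]
  add_mem' := by
    rintro ⟨G, H⟩ ⟨G', H'⟩ ⟨g, hg, hL, hQ, hF⟩ ⟨g', hg', hL', hQ', hF'⟩
    dsimp only at hL hL' hF hF'
    refine ⟨fun n => g n + g' n, fun n => add_mem (hg n) (hg' n), ?_, ?_, fun f hf => ?_⟩
    · have hsum := hL.add hL'
      rw [add_zero] at hsum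
      refine tendsto_of_tendsto_of_tendsto_of_le_of_le tendsto_const_nhds hsum
        (fun _ => bot_le) fun n => ?_
      have hae : (g n + g' n) - ⇑(G + G') =ᵐ[pathMeasure W] (g n - ⇑G) + (g' n - ⇑G') := by
        filter_upwards [Lp.coeFn_add G G'] with x hx
        simp only [Pi.sub_apply, Pi.add_apply, hx]
        ring
      simp only [Prod.mk_add_mk]
      rw [eLpNorm_congr_ae hae]
      exact eLpNorm_add_le
        ((formDomain_props (hg n)).1.aestronglyMeasurable.sub (Lp.aestronglyMeasurable G))
        ((formDomain_props (hg' n)).1.aestronglyMeasurable.sub (Lp.aestronglyMeasurable G'))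
        one_le_two
    · have hsum := (hQ.norm.const_mul 2).add (hQ'.norm.const_mul 2)
      simp only [norm_zero, mul_zero, add_zero] at hsum
      refine squeeze_zero_norm (fun k => ?_) hsum
      have e : g k.1 + g' k.1 - (g k.2 + g' k.2) = (g k.1 - g k.2) + (g' k.1 - g' k.2) := by
        abel
      rw [e]
      exact norm_dirichletForm_add_le W s (sub_mem (hg _) (hg _)) (sub_mem (hg' _) (hg' _))
    · have hsum := (hF f hf).add (hF' f hf)
      have e1 : ∀ n, dirichletForm W s f (g n + g' n) =
          dirichletForm W s f (g n) + dirichletForm W s f (g' n) :=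
        fun n => dirichletForm_add_right W s hf (hg n) (hg' n)
      have e2 : ∫ x, starRingEnd ℂ (f x) * (H + H' : PathL2 W) x ∂(pathMeasure W) =
          ∫ x, starRingEnd ℂ (f x) * H x ∂(pathMeasure W) +
          ∫ x, starRingEnd ℂ (f x) * H' x ∂(pathMeasure W) := by
        rw [← integral_add (integrable_conj_mul W hf H) (integrable_conj_mul W hf H')]
        refine integral_congr_ae ?_
        filter_upwards [Lp.coeFn_add H H'] with x hx
        rw [hx, Pi.add_apply]
        ring
      simp only [Prod.mk_add_mk]
      simp only [e1, e2, neg_add]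
      exact hsum
  smul_mem' := by
    rintro c ⟨G, H⟩ ⟨g, hg, hL, hQ, hF⟩
    dsimp only at hL hF
    refine ⟨fun n => c • g n, fun n => Submodule.smul_mem _ c (hg n), ?_, ?_, fun f hf => ?_⟩
    · have hmul := ENNReal.Tendsto.const_mul (a := ‖c‖ₑ) hL (Or.inr enorm_ne_top)
      rw [mul_zero] at hmul
      refine hmul.congr fun n => ?_
      have hae : c • g n - ⇑(c • G) =ᵐ[pathMeasure W] c • (g n - ⇑G) := by
        filter_upwards [Lp.coeFn_smul c G] with x hx
        simp only [Pi.sub_apply, Pi.smul_apply, hx, smul_sub]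
      simp only [Prod.smul_mk]
      rw [eLpNorm_congr_ae hae, eLpNorm_const_smul]
    · have hmul := hQ.norm.const_mul (‖c‖ ^ 2)
      simp only [norm_zero, mul_zero] at hmul
      refine squeeze_zero_norm (fun k => le_of_eq ?_) hmul
      rw [← smul_sub, norm_dirichletForm_smul W s c (sub_mem (hg _) (hg _))]
    · have hmul := (hF f hf).const_mul c
      have e1 : ∀ n, dirichletForm W s f (c • g n) = c * dirichletForm W s f (g n) :=
        fun n => dirichletForm_smul_right W s c hf (hg n)
      have e2 : ∫ x, starRingEnd ℂ (f x) * (c • H : PathL2 W) x ∂(pathMeasure W) =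
          c * ∫ x, starRingEnd ℂ (f x) * H x ∂(pathMeasure W) := by
        rw [← integral_const_mul]
        refine integral_congr_ae ?_
        filter_upwards [Lp.coeFn_smul c H] with x hx
        rw [hx, Pi.smul_apply, smul_eq_mul]
        ring
      simp only [Prod.smul_mk]
      simp only [e1, e2, ← mul_neg]
      exact hmul

/-- The Laplace–Beltrami operator, as an unbounded operator on `L²`. -/
def laplaceBeltrami [Nontrivial (Fin D)] (W : VertexWeights D) (s : ℝ) :
    PathL2 W →ₗ.[ℂ] PathL2 W :=
  (laplaceGraph W s).toLinearPMap

/-- The function `χ_[γ] / μ[γ]` in `L²`. -/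
def normalizedIndicator (W : VertexWeights D) (γ : FinPath D) : PathL2 W :=
  indicatorConstLp 2 (measurableSet_cylinder γ) (measure_ne_top (pathMeasure W) _)
    (((pathMeasure W).real (cylinderSet γ) : ℂ)⁻¹)

/-- The space `E_η`, spanned by the functions `χ_[ηe] / μ[ηe] - χ_[ηe'] / μ[ηe']`, where `ηe` and
`ηe'` are the extensions of `η` by two distinct vertices (i.e. edges with range `s(η)`). -/
def eigenSpan (W : VertexWeights D) (η : FinPath D) : Submodule ℂ (PathL2 W) :=
  Submodule.span ℂ {φ | ∃ e e' : Fin D, e ≠ e' ∧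
    φ = normalizedIndicator W (η ++ [e]) - normalizedIndicator W (η ++ [e'])}

/-- `E` is a nonzero space of eigenvectors of the operator `T` with eigenvalue `c`. -/
def HasEigenvalueOn {W : VertexWeights D} (T : PathL2 W →ₗ.[ℂ] PathL2 W)
    (E : Submodule ℂ (PathL2 W)) (c : ℂ) : Prop :=
  E ≠ ⊥ ∧ ∀ φ ∈ E, ∃ hφ : φ ∈ T.domain, T ⟨φ, hφ⟩ = c • φ

/-- `G_s(ξ) = ½ w(ξ)^(2-s) ∑_{e ≠ e'} μ[ξe] μ[ξe']`; in particular
`G_s(∘) = ½ ∑_{v ≠ v'} μ[v] μ[v']`. -/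
def G (W : VertexWeights D) (s : ℝ) (ξ : FinPath D) : ℝ :=
  1 / 2 * weight W ξ ^ (2 - s) * ∑ e ∈ (Finset.univ : Finset (Fin D)).offDiag,
    (pathMeasure W).real (cylinderSet (ξ ++ [e.1])) * (pathMeasure W).real (cylinderSet (ξ ++ [e.2]))

/-- The general formula `∑_{k=-1}^{|η|-1} (μ[η[0,k+1]] - μ[η[0,k]]) / G_s(η[0,k]) - μ[η] / G_s(η)`
for the eigenvalue belonging to `η`. As `η[0,k]` has `k + 1` vertices, it is `η.take (k + 1)`;
the index below is the number of vertices `k + 1`. -/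
def eigenvalueFormula (W : VertexWeights D) (s : ℝ) (η : FinPath D) : ℝ :=
  (∑ k ∈ Finset.range η.length, 1 / G W s (η.take k) *
    ((pathMeasure W).real (cylinderSet (η.take (k + 1))) -
      (pathMeasure W).real (cylinderSet (η.take k)))) -
    (pathMeasure W).real (cylinderSet η) / G W s η

end CuntzLaplacian

end

open CuntzLaplacian

/-! Dixmier measure. The weight is multiplicative on words, so the sum of `weight W γ ^ t` over
words of length `n` is `(∑ i, W.r i ^ t) ^ n`, and the whole sum is the geometric series `(1 - ∑ i,
W.r i ^ t)⁻¹`, finite for `t > 1` and divergent as `t` decreases to 1. Whatever the choice function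
is, a path extending `γ` has both chosen points in `[γ]`, and a path at least as long as `γ` that
does not extend it has neither. The twisted trace is therefore `weight W γ ^ t` times the full trace
plus finitely many bounded terms, and the quotient tends to `weight W γ`, the Markov measure of
`[γ]` (`isDixmierMeasure_pathMeasure`).

Eigenvalues. With two vertices, the admissible pairs at `γ` form the rectangle `[γe] × [γe']`
together with its swap. The normalization of the measure and the power of the Dirac operator combine
to `1 / G W s γ`, so the block at `γ` is an explicit combination of integrals over the two children
of `[γ]` (`weight_rpow_mul_integral_pairing`). Pair an arbitrary `f` with `g = edgeDifference W η e
e'`. Blocks off the prefixes of `η` see a constant `g`. At a proper prefix, `g` vanishes on the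
branch not taken and has mean zero on the other one, so only the mass of the branch not taken
remains. At `η` itself `g` is constant on both children. Each block is thus a scalar times `⟨f, g⟩`,
and the scalars add up to minus the eigenvalue (`dirichletForm_edgeDifference`).

The operator. Its graph is defined by limits of sequences, so single-valuedness has to be proved
(`snd_eq_zero_of_mem_laplaceGraph`). For fixed `f` in the form domain only finitely many blocks
contribute, and each depends continuously on the other argument in `L²`; density of the form domain
finishes. As `g` lies in the form domain, the constant sequence `g` puts the eigenvector in the
graph. -/

noncomputable section

namespace CuntzLaplacian

/-! ### Cylinder sets, multiplicativity of weights, and the Markov measure -/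

section

variable {D : ℕ}

@[simp]
theorem length_initialSegment (x : InfPath D) (n : ℕ) : (initialSegment x n).length = n := by
  simp [initialSegment]

theorem take_initialSegment (x : InfPath D) {m n : ℕ} (h : m ≤ n) :
    (initialSegment x n).take m = initialSegment x m := by
  refine List.ext_getElem (by simp [h]) fun i h1 h2 => ?_
  simp [initialSegment]

theorem initialSegment_succ (x : InfPath D) (n : ℕ) :
    initialSegment x (n + 1) = initialSegment x n ++ [x n] := by
  rw [initialSegment, List.ofFn_succ_last]
  simp [initialSegment]

theorem mem_cylinderSet {γ : FinPath D} {x : InfPath D} :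
    x ∈ cylinderSet γ ↔ initialSegment x γ.length = γ := Iff.rfl

@[simp]
theorem cylinderSet_nil : cylinderSet ([] : FinPath D) = Set.univ := by
  ext x; simp [cylinderSet, initialSegment]

theorem mem_cylinderSet_take {γ : FinPath D} {x : InfPath D} (hx : x ∈ cylinderSet γ) (k : ℕ) :
    x ∈ cylinderSet (γ.take k) := by
  have h := mem_cylinderSet.1 hx
  rw [mem_cylinderSet, ← take_initialSegment x (List.length_take_le' k γ), h]
  exact List.prefix_iff_eq_take.1 (List.take_prefix k γ) |>.symm

theorem cylinderSet_anti {γ η : FinPath D} (h : γ <+: η) : cylinderSet η ⊆ cylinderSet γ := by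
  intro x hx
  rw [List.prefix_iff_eq_take.1 h]
  exact mem_cylinderSet_take hx _

/-- Both words are initial segments of the common point `x`; hence two cylinders are nested or
disjoint. -/
theorem eq_take_of_mem_cylinderSet {γ η : FinPath D} {x : InfPath D} (hγ : x ∈ cylinderSet γ)
    (hη : x ∈ cylinderSet η) (h : γ.length ≤ η.length) : γ = η.take γ.length := by
  have h1 := mem_cylinderSet.1 hγ
  have h2 := mem_cylinderSet.1 hη
  rw [← h2, take_initialSegment x h, h1]

theorem mem_cylinderSet_append_singleton {γ : FinPath D} {e : Fin D} {x : InfPath D} :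
    x ∈ cylinderSet (γ ++ [e]) ↔ x ∈ cylinderSet γ ∧ x γ.length = e := by
  rw [mem_cylinderSet, mem_cylinderSet]
  simp only [List.length_append, List.length_singleton, initialSegment_succ]
  constructor
  · intro h
    simpa using List.append_inj h (by simp)
  · rintro ⟨h1, h2⟩
    rw [h1, h2]

theorem disjoint_cylinderSet_append_singleton (γ : FinPath D) {e e' : Fin D} (h : e ≠ e') :
    Disjoint (cylinderSet (γ ++ [e])) (cylinderSet (γ ++ [e'])) := by
  rw [Set.disjoint_left]
  intro x hx hx'
  rw [mem_cylinderSet_append_singleton] at hx hx'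
  exact h (hx.2.symm.trans hx'.2)

theorem weight_append (W : VertexWeights D) (γ η : FinPath D) :
    weight W (γ ++ η) = weight W γ * weight W η := by
  simp [weight]

theorem weight_singleton (W : VertexWeights D) (e : Fin D) : weight W [e] = W.r e := by
  simp [weight]

@[simp]
theorem weight_nil (W : VertexWeights D) : weight W [] = 1 := by
  simp [weight]

theorem pathMeasure_real_cylinderSet (W : VertexWeights D) (γ : FinPath D) :
    (pathMeasure W).real (cylinderSet γ) = weight W γ := by
  classical
  by_cases hγ : γ = []
  · subst hγ; simp
  have hlen : 0 < γ.length := List.length_pos_iff.2 hγ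
  have : cylinderSet γ = Set.pi (Finset.range γ.length : Finset ℕ)
      (fun i => {γ.getD i (γ.get ⟨0, hlen⟩)}) := by
    ext x
    rw [mem_cylinder_iff]
    simp only [Finset.coe_range, Set.mem_pi, Set.mem_Iio, Set.mem_singleton_iff]
    constructor
    · intro h i hi
      rw [List.getD_eq_getElem _ _ hi]
      exact h ⟨i, hi⟩
    · intro h i
      have := h i i.2
      rwa [List.getD_eq_getElem _ _ i.2] at this
  rw [Measure.real, this, pathMeasure,
    Measure.infinitePi_pi _ (fun i _ => measurableSet_singleton _), ENNReal.toReal_prod,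
    Finset.prod_range, weight, ← Fin.prod_univ_fun_getElem]
  refine Finset.prod_congr rfl fun i _ => ?_
  rw [vertexLaw_singleton, ENNReal.toReal_ofReal (W.pos _).le, List.getD_eq_getElem _ _ i.2]

theorem mem_choicePairs_of_ne (W : VertexWeights D) {γ : FinPath D} {x y : InfPath D}
    (hx : x ∈ cylinderSet γ) (hy : y ∈ cylinderSet γ) (h : x γ.length ≠ y γ.length) :
    (x, y) ∈ choicePairs W γ := by
  have hxy : x ≠ y := fun h' => h (by rw [h'])
  have hfd : PiNat.firstDiff x y = γ.length := by
    apply le_antisymm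
    · by_contra! hlt
      exact h (PiNat.apply_eq_of_lt_firstDiff hlt)
    · by_contra! hlt
      exact PiNat.apply_firstDiff_ne hxy
        (((mem_cylinder_iff _ _).1 hx ⟨_, hlt⟩).trans ((mem_cylinder_iff _ _).1 hy ⟨_, hlt⟩).symm)
  refine ⟨hx, hy, ?_⟩
  simp only [pathDist, if_neg hxy, hfd]
  rw [mem_cylinderSet.1 hx]

/-! ### Two vertices: admissible pairs as rectangles, and the closed form of `G` -/

section TwoVertices

variable (W : VertexWeights 2)

theorem r_add_r {e e' : Fin 2} (h : e ≠ e') : W.r e + W.r e' = 1 := by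
  have := W.sum_eq_one
  rw [Fin.sum_univ_two] at this
  fin_cases e <;> fin_cases e' <;> (simp_all; try linarith)

theorem r_lt_one (e : Fin 2) : W.r e < 1 := by
  obtain ⟨e', h⟩ := exists_ne e
  linarith [r_add_r W h, W.pos e']

/-- Every vertex weight is below 1. Along a fixed `x`, the weight of an initial segment therefore
determines its length, which turns the distance condition on a choice function into a condition on
the splitting level. -/
theorem weight_initialSegment_strictAnti (x : InfPath 2) :
    StrictAnti fun n => weight W (initialSegment x n) := by
  refine strictAnti_nat_of_succ_lt fun n => ?_
  rw [initialSegment_succ, weight_append, weight_singleton]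
  exact mul_lt_of_lt_one_right (weight_pos W _) (r_lt_one W _)

/-- The distance condition forces the two points to separate exactly at index `γ.length`, and two
vertices can be distributed there in only two ways. -/
theorem choicePairs_eq (γ : FinPath 2) {e e' : Fin 2} (h : e ≠ e') :
    choicePairs W γ = cylinderSet (γ ++ [e]) ×ˢ cylinderSet (γ ++ [e']) ∪
      cylinderSet (γ ++ [e']) ×ˢ cylinderSet (γ ++ [e]) := by
  ext ⟨x, y⟩
  simp only [Set.mem_union, Set.mem_prod, mem_cylinderSet_append_singleton]
  constructor
  · rintro ⟨hx, hy, hd⟩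
    have hxy : x ≠ y := by
      rintro rfl
      have := weight_pos W γ
      simp [pathDist] at hd
      linarith
    simp only [pathDist, if_neg hxy] at hd
    have hw : weight W (initialSegment x (PiNat.firstDiff x y)) =
        weight W (initialSegment x γ.length) := by rw [hd, mem_cylinderSet.1 hx]
    have hn := (weight_initialSegment_strictAnti W x).injective hw
    have hne := PiNat.apply_firstDiff_ne hxy
    rw [hn] at hne
    have key : ∀ a b : Fin 2, a ≠ b → (a = e ∧ b = e') ∨ (a = e' ∧ b = e) := by
      revert e e'; decide
    rcases key _ _ hne with h' | h'
    · exact Or.inl ⟨⟨hx, h'.1⟩, hy, h'.2⟩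
    · exact Or.inr ⟨⟨hx, h'.1⟩, hy, h'.2⟩
  · rintro (⟨⟨hx, rfl⟩, hy, rfl⟩ | ⟨⟨hx, rfl⟩, hy, rfl⟩)
    · exact mem_choicePairs_of_ne W hx hy h
    · exact mem_choicePairs_of_ne W hx hy h.symm

theorem prod_real_choicePairs (γ : FinPath 2) :
    ((pathMeasure W).prod (pathMeasure W)).real (choicePairs W γ) =
      2 * (W.r 0 * W.r 1) * weight W γ ^ 2 := by
  rw [choicePairs_eq W γ (zero_ne_one), measureReal_union, measureReal_prod_prod,
    measureReal_prod_prod]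
  · simp only [pathMeasure_real_cylinderSet, weight_append, weight_singleton]
    ring
  · exact Set.disjoint_prod.2 (Or.inl (disjoint_cylinderSet_append_singleton γ zero_ne_one))
  · exact (measurableSet_cylinder _).prod (measurableSet_cylinder _)

/-- A symmetric function is integrated over the admissible pairs at `γ` by integrating over one of
the two rectangles that make up this set. -/
theorem integral_choicePairMeasure (γ : FinPath 2) {e e' : Fin 2} (h : e ≠ e')
    {F : InfPath 2 × InfPath 2 → ℂ} (hF : Integrable F ((pathMeasure W).prod (pathMeasure W)))
    (hs : ∀ p, F p.swap = F p) :
    ∫ p, F p ∂(choicePairMeasure W γ) = ((W.r 0 * W.r 1 * weight W γ ^ 2 : ℝ) : ℂ)⁻¹ *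
      ∫ p in cylinderSet (γ ++ [e]) ×ˢ cylinderSet (γ ++ [e']), F p
        ∂((pathMeasure W).prod (pathMeasure W)) := by
  have hswap : ∫ p in cylinderSet (γ ++ [e']) ×ˢ cylinderSet (γ ++ [e]), F p
        ∂((pathMeasure W).prod (pathMeasure W)) =
      ∫ p in cylinderSet (γ ++ [e]) ×ˢ cylinderSet (γ ++ [e']), F p
        ∂((pathMeasure W).prod (pathMeasure W)) := by
    rw [← setIntegral_prod_swap]
    exact integral_congr_ae (Eventually.of_forall fun p => hs p)
  have hd : Disjoint (cylinderSet (γ ++ [e]) ×ˢ cylinderSet (γ ++ [e']))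
      (cylinderSet (γ ++ [e']) ×ˢ cylinderSet (γ ++ [e])) :=
    Set.disjoint_prod.2 (Or.inl (disjoint_cylinderSet_append_singleton γ h))
  have hw := weight_pos W γ
  have h0 := W.pos 0
  have h1 := W.pos 1
  rw [choicePairMeasure, ProbabilityTheory.cond, integral_smul_measure, ENNReal.toReal_inv,
    ← Measure.real, prod_real_choicePairs, choicePairs_eq W γ h,
    setIntegral_union hd ((measurableSet_cylinder _).prod (measurableSet_cylinder _))
      hF.integrableOn hF.integrableOn, hswap, ← two_mul, Complex.real_smul]
  push_cast
  have hw' : (weight W γ : ℂ) ≠ 0 := by exact_mod_cast hw.ne'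
  have h0' : (W.r 0 : ℂ) ≠ 0 := by exact_mod_cast h0.ne'
  have h1' : (W.r 1 : ℂ) ≠ 0 := by exact_mod_cast h1.ne'
  field_simp

/-- The two ordered pairs of distinct vertices give equal products, which cancels the factor `1 /
2`; the two child masses supply `weight W ξ ^ 2`. -/
theorem G_eq (s : ℝ) (ξ : FinPath 2) :
    G W s ξ = weight W ξ ^ (4 - s) * (W.r 0 * W.r 1) := by
  have hw := weight_pos W ξ
  have hd : (Finset.univ : Finset (Fin 2)).offDiag = {(0, 1), (1, 0)} := by decide
  have h2 : weight W ξ ^ (4 - s) = weight W ξ ^ (2 - s) * weight W ξ ^ 2 := by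
    rw [← Real.rpow_natCast, ← Real.rpow_add hw]
    congr 1
    push_cast
    ring
  rw [G, hd, Finset.sum_pair (by decide), h2]
  simp only [pathMeasure_real_cylinderSet, weight_append, weight_singleton]
  ring

end TwoVertices

end

/-! ### The zeta function of the Dirac operator and the Dixmier measure -/

section

/-- Sum over words, graded by length. -/
theorem hasSum_list_prod {α : Type*} [Fintype α] {f : α → ℝ} (hf : ∀ a, 0 ≤ f a)
    (h : ∑ a, f a < 1) :
    HasSum (fun l : List α => (l.map f).prod) (1 - ∑ a, f a)⁻¹ := by
  have h0 : 0 ≤ ∑ a, f a := Finset.sum_nonneg fun a _ => hf a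
  have hterm : ∀ p : Σ n, Fin n → α,
      ((List.equivSigmaTuple.symm p).map f).prod = ∏ i, f (p.2 i) := by
    rintro ⟨n, v⟩
    simp [List.equivSigmaTuple, List.map_ofFn, List.prod_ofFn]
  have hfib : ∀ n : ℕ, ∑ v : Fin n → α, ∏ i, f (v i) = (∑ a, f a) ^ n := fun n => by
    simpa using (Fintype.sum_pow f n).symm
  rw [← List.equivSigmaTuple.symm.hasSum_iff]
  have hgeom := hasSum_geometric_of_lt_one h0 h
  -- All terms are nonnegative, so summability over the sigma type reduces to the finite fibres and
  -- the geometric series of fibre sums.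
  have hs : Summable fun p : Σ n, Fin n → α => ∏ i, f (p.2 i) := by
    refine (summable_sigma_of_nonneg fun p => Finset.prod_nonneg fun i _ => hf _).2
      ⟨fun n => Summable.of_finite, ?_⟩
    simp only [tsum_fintype, hfib]
    exact hgeom.summable
  refine HasSum.congr_fun (f := fun p : Σ n, Fin n → α => ∏ i, f (p.2 i)) ?_ ?_
  · have := hs.hasSum.sigma (fun n => hasSum_fintype _)
    simp only [hfib] at this
    rw [← this.unique hgeom]
    exact hs.hasSum
  · exact hterm

variable (W : VertexWeights 2)

theorem sum_rpow_lt_one {t : ℝ} (ht : 1 < t) : ∑ i, W.r i ^ t < 1 := by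
  rw [← W.sum_eq_one]
  refine Finset.sum_lt_sum_of_nonempty Finset.univ_nonempty fun i _ => ?_
  exact Real.rpow_lt_self_of_lt_one (W.pos i) (r_lt_one W i) ht

theorem weight_rpow (γ : FinPath 2) (t : ℝ) :
    weight W γ ^ t = (γ.map fun i => W.r i ^ t).prod := by
  induction γ with
  | nil => simp
  | cons a l ih =>
    rw [List.map_cons, List.prod_cons, ← ih, ← Real.mul_rpow (W.pos a).le (weight_pos W l).le]
    simp [weight]

theorem hasSum_weight_rpow {t : ℝ} (ht : 1 < t) :
    HasSum (fun γ : FinPath 2 => weight W γ ^ t) (1 - ∑ i, W.r i ^ t)⁻¹ := by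
  simp only [weight_rpow]
  exact hasSum_list_prod (fun i => Real.rpow_nonneg (W.pos i).le t) (sum_rpow_lt_one W ht)

/-- The `ζ`-function of the Dirac operator. -/
theorem blockTrace_absDiracPow {t : ℝ} (ht : 1 < t) :
    blockTrace (absDiracPow W t) = ((2 * (1 - ∑ i, W.r i ^ t)⁻¹ : ℝ) : ℂ) := by
  have h : HasSum (fun γ : FinPath 2 => ((2 * weight W γ ^ t : ℝ) : ℂ)) _ :=
    Complex.hasSum_ofReal.2 ((hasSum_weight_rpow W ht).mul_left 2)
  rw [blockTrace, ← h.tsum_eq]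
  refine tsum_congr fun γ => ?_
  rw [absDiracPow, Matrix.trace_smul, Matrix.trace_one]
  simp [mul_comm]

/-- The twisted `ζ`-function, up to the finitely many terms of paths shorter than `γ`. -/
theorem blockTrace_absDiracPow_mul_pathRepr {t : ℝ} (ht : 1 < t)
    {τ : FinPath 2 → InfPath 2 × InfPath 2} (hτ : IsChoiceFunction W τ) (γ : FinPath 2) :
    blockTrace (fun η => absDiracPow W t η * pathRepr τ ((cylinderSet γ).indicator 1) η) =
      ((2 * weight W γ ^ t * (1 - ∑ i, W.r i ^ t)⁻¹ : ℝ) : ℂ) +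
      ∑ η ∈ (List.finite_length_lt (Fin 2) γ.length).toFinset, ((weight W η ^ t : ℝ) : ℂ) *
        ((cylinderSet γ).indicator 1 (τ η).1 + (cylinderSet γ).indicator 1 (τ η).2) := by
  set S := (List.finite_length_lt (Fin 2) γ.length).toFinset with hS
  set c : FinPath 2 → ℂ := fun η =>
    (cylinderSet γ).indicator 1 (τ η).1 + (cylinderSet γ).indicator 1 (τ η).2 with hc
  have hmemS : ∀ η, η ∈ S ↔ η.length < γ.length := fun η => by simp [hS]
  have htr : ∀ η, (absDiracPow W t η * pathRepr τ ((cylinderSet γ).indicator 1) η).trace =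
      ((weight W η ^ t : ℝ) : ℂ) * c η := fun η => by
    simp [absDiracPow, pathRepr, Matrix.trace, Fin.sum_univ_two, hc, mul_add]
  have hinj : Function.Injective fun l : FinPath 2 => γ ++ l := fun a b h => by simpa using h
  -- Paths at least as long as `γ` contribute only through the words `γ ++ l`, so the sum is pulled
  -- back along the injection `l ↦ γ ++ l`.
  have hlong : HasSum (fun η => if η ∈ S then 0 else ((weight W η ^ t : ℝ) : ℂ) * c η)
      ((2 * weight W γ ^ t * (1 - ∑ i, W.r i ^ t)⁻¹ : ℝ) : ℂ) := by
    rw [← hinj.hasSum_iff]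
    · have h : HasSum (fun l : FinPath 2 => ((2 * weight W γ ^ t * weight W l ^ t : ℝ) : ℂ)) _ :=
        Complex.hasSum_ofReal.2 ((hasSum_weight_rpow W ht).mul_left (2 * weight W γ ^ t))
      refine h.congr_fun (fun l => ?_)
      have hl : γ ++ l ∉ S := by simp [hmemS]
      have hpre : cylinderSet (γ ++ l) ⊆ cylinderSet γ := cylinderSet_anti (List.prefix_append _ _)
      have h1 := hpre (hτ (γ ++ l)).1
      have h2 := hpre (hτ (γ ++ l)).2.1
      simp only [Function.comp, if_neg hl, hc, Set.indicator_of_mem h1, Set.indicator_of_mem h2,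
        weight_append, Real.mul_rpow (weight_pos W γ).le (weight_pos W l).le, Pi.one_apply]
      push_cast
      ring
    · intro η hη
      split_ifs with hηS
      · rfl
      · rw [hmemS, not_lt] at hηS
        have hnot : ∀ x ∈ cylinderSet η, x ∉ cylinderSet γ := fun x hx hxγ => hη
          ⟨η.drop γ.length, by
            have := eq_take_of_mem_cylinderSet hxγ hx hηS
            conv_lhs => rw [this]
            simp [List.take_append_drop, hηS]⟩
        simp [hc, hnot _ (hτ η).1, hnot _ (hτ η).2.1]
  have hshort : HasSum (fun η => if η ∈ S then ((weight W η ^ t : ℝ) : ℂ) * c η else 0)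
      (∑ η ∈ S, ((weight W η ^ t : ℝ) : ℂ) * c η) := by
    have : HasSum (fun η => if η ∈ S then ((weight W η ^ t : ℝ) : ℂ) * c η else 0)
        (∑ η ∈ S, if η ∈ S then ((weight W η ^ t : ℝ) : ℂ) * c η else 0) :=
      hasSum_sum_of_ne_finset_zero fun η hη => if_neg hη
    rwa [Finset.sum_congr rfl fun η hη => if_pos hη] at this
  rw [blockTrace, ← (hlong.add hshort).tsum_eq]
  refine tsum_congr fun η => ?_
  rw [htr]
  split_ifs <;> simp

/-- After division by the zeta function, the terms of the short paths carry the factor `1 - ∑ i, W.r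
i ^ t`, which vanishes at `t = 1`. -/
theorem isDixmierMeasure_pathMeasure : IsDixmierMeasure W (pathMeasure W) := by
  intro τ hτ γ
  rw [pathMeasure_real_cylinderSet]
  -- `F` is the quotient of traces with the diverging factor cancelled: it agrees with the quotient
  -- for `t > 1` and is continuous at 1 as well, so the limit is `F 1`.
  set F : ℝ → ℂ := fun t =>
    ((weight W γ ^ t : ℝ) : ℂ) + ((1 - ∑ i, W.r i ^ t : ℝ) : ℂ) / 2 *
      ∑ η ∈ (List.finite_length_lt (Fin 2) γ.length).toFinset, ((weight W η ^ t : ℝ) : ℂ) *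
        ((cylinderSet γ).indicator 1 (τ η).1 + (cylinderSet γ).indicator 1 (τ η).2) with hF
  have hpow : ∀ a : ℝ, 0 < a → Continuous fun t : ℝ => a ^ t :=
    fun a ha => Real.continuous_const_rpow ha.ne'
  have hcont : Continuous F := by
    have h1 : ∀ η : FinPath 2, Continuous fun t : ℝ => ((weight W η ^ t : ℝ) : ℂ) :=
      fun η => Complex.continuous_ofReal.comp (hpow _ (weight_pos W η))
    have h2 : Continuous fun t : ℝ => ((1 - ∑ i, W.r i ^ t : ℝ) : ℂ) :=
      Complex.continuous_ofReal.comp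
        (continuous_const.sub (continuous_finsetSum _ fun i _ => hpow _ (W.pos i)))
    exact (h1 γ).add ((h2.div_const 2).mul
      (continuous_finsetSum _ fun η _ => (h1 η).mul continuous_const))
  have hF1 : F 1 = ((weight W γ : ℝ) : ℂ) := by
    simp only [hF, Real.rpow_one, W.sum_eq_one]
    simp
  rw [← hF1]
  refine (hcont.continuousAt.tendsto.mono_left nhdsWithin_le_nhds).congr' ?_
  filter_upwards [self_mem_nhdsWithin] with t ht
  have hpos : (1 - ∑ i, W.r i ^ t) ≠ 0 := (sub_pos.2 (sum_rpow_lt_one W ht)).ne'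
  have hpos' : ((1 - ∑ i, W.r i ^ t : ℝ) : ℂ) ≠ 0 := by exact_mod_cast hpos
  rw [blockTrace_absDiracPow W ht, blockTrace_absDiracPow_mul_pathRepr W ht hτ γ]
  simp only [hF, Complex.ofReal_mul, Complex.ofReal_inv, Complex.ofReal_ofNat]
  field_simp

end

/-! ### The Dirichlet form evaluated on differences of normalized indicators -/

section

theorem integrable_of_mem_formDomain {D : ℕ} (W : VertexWeights D) {f : InfPath D → ℂ}
    (hf : f ∈ formDomain D) : Integrable f (pathMeasure W) := by
  obtain ⟨hfm, ⟨C, hC⟩, -⟩ := formDomain_props hf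
  exact Integrable.of_bound hfm.aestronglyMeasurable C (Eventually.of_forall hC)

theorem integrable_conj_of_mem_formDomain {D : ℕ} (W : VertexWeights D) {f : InfPath D → ℂ}
    (hf : f ∈ formDomain D) : Integrable (fun x => starRingEnd ℂ (f x)) (pathMeasure W) := by
  obtain ⟨hfm, ⟨C, hC⟩, -⟩ := formDomain_props hf
  exact Integrable.of_bound (Complex.continuous_conj.measurable.comp hfm).aestronglyMeasurable C
    (Eventually.of_forall fun x => by simpa using hC x)

theorem integrable_conj_mul_of_mem_formDomain {D : ℕ} (W : VertexWeights D) {f g : InfPath D → ℂ}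
    (hf : f ∈ formDomain D) (hg : g ∈ formDomain D) :
    Integrable (fun x => starRingEnd ℂ (f x) * g x) (pathMeasure W) := by
  obtain ⟨hfm, ⟨C, hC⟩, -⟩ := formDomain_props hf
  exact (integrable_of_mem_formDomain W hg).bdd_mul (c := C)
    (Complex.continuous_conj.measurable.comp hfm).aestronglyMeasurable
    (Eventually.of_forall fun x => by simpa using hC x)

/-- Expanding the product gives four terms, each a function of `p.1` times a function of `p.2`, and
Fubini splits each integral over the rectangle. -/
theorem setIntegral_prod_pairing {D : ℕ} (W : VertexWeights D) {f g : InfPath D → ℂ}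
    (hf : f ∈ formDomain D) (hg : g ∈ formDomain D) (A B : Set (InfPath D)) :
    ∫ p in A ×ˢ B, starRingEnd ℂ (f p.1 - f p.2) * (g p.1 - g p.2)
        ∂((pathMeasure W).prod (pathMeasure W)) =
      (pathMeasure W).real B * (∫ x in A, starRingEnd ℂ (f x) * g x ∂(pathMeasure W)) +
      (pathMeasure W).real A * (∫ x in B, starRingEnd ℂ (f x) * g x ∂(pathMeasure W)) -
      (∫ x in A, starRingEnd ℂ (f x) ∂(pathMeasure W)) * (∫ x in B, g x ∂(pathMeasure W)) -
      (∫ x in B, starRingEnd ℂ (f x) ∂(pathMeasure W)) * (∫ x in A, g x ∂(pathMeasure W)) := by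
  have hfi := integrable_conj_of_mem_formDomain W hf
  have hgi := integrable_of_mem_formDomain W hg
  have hfg := integrable_conj_mul_of_mem_formDomain W hf hg
  have h1 : Integrable (fun _ : InfPath D => (1 : ℂ)) (pathMeasure W) := integrable_const _
  have i1 := (hfg.mul_prod h1).integrableOn (s := A ×ˢ B)
  have i2 := (h1.mul_prod hfg).integrableOn (s := A ×ˢ B)
  have i3 := (hfi.mul_prod hgi).integrableOn (s := A ×ˢ B)
  have i4 := (hgi.mul_prod hfi).integrableOn (s := A ×ˢ B)
  -- The factors `1` put the two unmixed terms in product form as well.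
  have e : ∀ p : InfPath D × InfPath D, starRingEnd ℂ (f p.1 - f p.2) * (g p.1 - g p.2) =
      starRingEnd ℂ (f p.1) * g p.1 * 1 + 1 * (starRingEnd ℂ (f p.2) * g p.2) -
      starRingEnd ℂ (f p.1) * g p.2 - g p.1 * starRingEnd ℂ (f p.2) := fun p => by
    rw [map_sub]; ring
  simp only [e]
  have s1 := integral_sub ((i1.add i2).sub i3) i4
  have s2 := integral_sub (i1.add i2) i3
  simp only [Pi.add_apply, Pi.sub_apply] at s1 s2
  rw [s1, s2, integral_add i1 i2]
  rw [setIntegral_prod_mul (fun x => starRingEnd ℂ (f x) * g x) (fun _ => (1 : ℂ)),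
    setIntegral_prod_mul (fun _ => (1 : ℂ)) (fun x => starRingEnd ℂ (f x) * g x),
    setIntegral_prod_mul (fun x => starRingEnd ℂ (f x)) g,
    setIntegral_prod_mul g (fun x => starRingEnd ℂ (f x)), setIntegral_const, setIntegral_const]
  simp only [Complex.real_smul, mul_one]
  ring

theorem pairing_integrable_prod {D : ℕ} (W : VertexWeights D) {f g : InfPath D → ℂ}
    (hf : f ∈ formDomain D) (hg : g ∈ formDomain D) :
    Integrable (fun p : InfPath D × InfPath D =>
      starRingEnd ℂ (f p.1 - f p.2) * (g p.1 - g p.2))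
      ((pathMeasure W).prod (pathMeasure W)) := by
  have hfi := integrable_conj_of_mem_formDomain W hf
  have hgi := integrable_of_mem_formDomain W hg
  have hfg := integrable_conj_mul_of_mem_formDomain W hf hg
  have h1 : Integrable (fun _ : InfPath D => (1 : ℂ)) (pathMeasure W) := integrable_const _
  refine ((((hfg.mul_prod h1).add (h1.mul_prod hfg)).sub (hfi.mul_prod hgi)).sub
    (hgi.mul_prod hfi)).congr (Eventually.of_forall fun p => ?_)
  simp only [Pi.add_apply, Pi.sub_apply, map_sub]
  ring

variable (W : VertexWeights 2)

/-- This is the working formula for one block of the form. The pairing is invariant under swapping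
the two points, so one rectangle suffices, and the normalizing constant merges with `weight W γ ^ (s
- 2)` into `1 / G W s γ`. -/
theorem weight_rpow_mul_integral_pairing (s : ℝ) {f g : InfPath 2 → ℂ} (hf : f ∈ formDomain 2)
    (hg : g ∈ formDomain 2) (γ : FinPath 2) {e e' : Fin 2} (h : e ≠ e') :
    ((weight W γ ^ (s - 2) : ℝ) : ℂ) *
      ∫ p, starRingEnd ℂ (f p.1 - f p.2) * (g p.1 - g p.2) ∂(choicePairMeasure W γ) =
    ((1 / G W s γ : ℝ) : ℂ) *
      (weight W (γ ++ [e']) *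
        (∫ x in cylinderSet (γ ++ [e]), starRingEnd ℂ (f x) * g x ∂(pathMeasure W)) +
      weight W (γ ++ [e]) *
        (∫ x in cylinderSet (γ ++ [e']), starRingEnd ℂ (f x) * g x ∂(pathMeasure W)) -
      (∫ x in cylinderSet (γ ++ [e]), starRingEnd ℂ (f x) ∂(pathMeasure W)) *
        (∫ x in cylinderSet (γ ++ [e']), g x ∂(pathMeasure W)) -
      (∫ x in cylinderSet (γ ++ [e']), starRingEnd ℂ (f x) ∂(pathMeasure W)) *
        (∫ x in cylinderSet (γ ++ [e]), g x ∂(pathMeasure W))) := by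
  have hw := weight_pos W γ
  have hG : weight W γ ^ (s - 2) * (W.r 0 * W.r 1 * weight W γ ^ 2)⁻¹ = 1 / G W s γ := by
    have h2 : weight W γ ^ (s - 2) = weight W γ ^ 2 * (weight W γ ^ (4 - s))⁻¹ := by
      rw [← Real.rpow_natCast, ← Real.rpow_neg hw.le, ← Real.rpow_add hw]
      congr 1
      push_cast
      ring
    have h0 := (W.pos 0).ne'
    have h1 := (W.pos 1).ne'
    have h3 := (Real.rpow_pos_of_pos hw (4 - s)).ne'
    rw [G_eq, h2]
    field_simp
  rw [integral_choicePairMeasure W γ h (pairing_integrable_prod W hf hg), ← mul_assoc,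
    ← Complex.ofReal_inv, ← Complex.ofReal_mul, hG, setIntegral_prod_pairing W hf hg,
    pathMeasure_real_cylinderSet, pathMeasure_real_cylinderSet]
  intro p
  simp only [Prod.fst_swap, Prod.snd_swap, map_sub]
  ring

/-- The function `χ_[ηe] / μ[ηe] - χ_[ηe'] / μ[ηe']`. -/
def edgeDifference (η : FinPath 2) (e e' : Fin 2) : InfPath 2 → ℂ :=
  (weight W (η ++ [e]) : ℂ)⁻¹ • (cylinderSet (η ++ [e])).indicator 1 -
    (weight W (η ++ [e']) : ℂ)⁻¹ • (cylinderSet (η ++ [e'])).indicator 1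

variable {W}

theorem edgeDifference_mem_formDomain (η : FinPath 2) (e e' : Fin 2) :
    edgeDifference W η e e' ∈ formDomain 2 :=
  sub_mem (Submodule.smul_mem _ _ (Submodule.subset_span ⟨_, rfl⟩))
    (Submodule.smul_mem _ _ (Submodule.subset_span ⟨_, rfl⟩))

theorem edgeDifference_of_mem_left {η : FinPath 2} {e e' : Fin 2} (h : e ≠ e') {x : InfPath 2}
    (hx : x ∈ cylinderSet (η ++ [e])) :
    edgeDifference W η e e' x = (weight W (η ++ [e]) : ℂ)⁻¹ := by
  have hx' := Set.disjoint_left.1 (disjoint_cylinderSet_append_singleton η h) hx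
  simp [edgeDifference, hx, hx']

theorem edgeDifference_of_mem_right {η : FinPath 2} {e e' : Fin 2} (h : e ≠ e') {x : InfPath 2}
    (hx : x ∈ cylinderSet (η ++ [e'])) :
    edgeDifference W η e e' x = -(weight W (η ++ [e']) : ℂ)⁻¹ := by
  have hx' := Set.disjoint_right.1 (disjoint_cylinderSet_append_singleton η h) hx
  simp [edgeDifference, hx, hx']

theorem edgeDifference_of_notMem {η : FinPath 2} {e e' : Fin 2} {x : InfPath 2}
    (hx : x ∉ cylinderSet η) : edgeDifference W η e e' x = 0 := by
  have h1 : ∀ a, x ∉ cylinderSet (η ++ [a]) := fun a ha =>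
    hx (mem_cylinderSet_append_singleton.1 ha).1
  simp [edgeDifference, h1]

theorem edgeDifference_congr (η : FinPath 2) (e e' : Fin 2) (x y : InfPath 2)
    (h : ∀ i < η.length + 1, x i = y i) :
    edgeDifference W η e e' x = edgeDifference W η e e' y := by
  have h1 : ∀ a, x ∈ cylinderSet (η ++ [a]) ↔ y ∈ cylinderSet (η ++ [a]) := fun a => by
    rw [mem_cylinder_iff, mem_cylinder_iff]
    exact forall_congr' fun i => by rw [h i (by simpa using i.2)]
  have h2 : ∀ a, (cylinderSet (η ++ [a])).indicator (1 : InfPath 2 → ℂ) x =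
      (cylinderSet (η ++ [a])).indicator 1 y := fun a => by
    by_cases hx : x ∈ cylinderSet (η ++ [a])
    · simp [hx, (h1 a).1 hx]
    · simp [hx, mt (h1 a).2 hx]
  simp only [edgeDifference, Pi.sub_apply, Pi.smul_apply, h2]

theorem integral_conj_mul_edgeDifference {f : InfPath 2 → ℂ} (hf : f ∈ formDomain 2)
    (η : FinPath 2) (e e' : Fin 2) :
    ∫ x, starRingEnd ℂ (f x) * edgeDifference W η e e' x ∂(pathMeasure W) =
      (weight W (η ++ [e]) : ℂ)⁻¹ *
        (∫ x in cylinderSet (η ++ [e]), starRingEnd ℂ (f x) ∂(pathMeasure W)) -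
      (weight W (η ++ [e']) : ℂ)⁻¹ *
        (∫ x in cylinderSet (η ++ [e']), starRingEnd ℂ (f x) ∂(pathMeasure W)) := by
  have hfi := integrable_conj_of_mem_formDomain W hf
  rw [← integral_indicator (measurableSet_cylinder _),
    ← integral_indicator (measurableSet_cylinder _), ← integral_const_mul, ← integral_const_mul,
    ← integral_sub ((hfi.indicator (measurableSet_cylinder _)).const_mul _)
      ((hfi.indicator (measurableSet_cylinder _)).const_mul _)]
  refine integral_congr_ae (Eventually.of_forall fun x => ?_)
  by_cases h1 : x ∈ cylinderSet (η ++ [e]) <;> by_cases h2 : x ∈ cylinderSet (η ++ [e']) <;>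
    simp [edgeDifference, h1, h2] <;> ring

theorem one_mem_formDomain : (1 : InfPath 2 → ℂ) ∈ formDomain 2 := by
  have : (cylinderSet ([] : FinPath 2)).indicator (1 : InfPath 2 → ℂ) = 1 := by simp
  rw [← this]
  exact Submodule.subset_span ⟨_, rfl⟩

/-- Each normalized indicator has integral 1, which is the pairing formula at `f = 1`. This
cancellation removes the last cross term at proper prefixes. -/
theorem integral_edgeDifference (η : FinPath 2) (e e' : Fin 2) :
    ∫ x, edgeDifference W η e e' x ∂(pathMeasure W) = 0 := by
  have h := integral_conj_mul_edgeDifference (W := W) one_mem_formDomain η e e'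
  have hc : ∀ a : Fin 2, (weight W (η ++ [a]) : ℂ) ≠ 0 := fun a => by
    exact_mod_cast (weight_pos W _).ne'
  simpa [setIntegral_const, pathMeasure_real_cylinderSet, hc] using h

theorem weight_append_add_weight_append (η : FinPath 2) {e e' : Fin 2} (h : e ≠ e') :
    weight W (η ++ [e]) + weight W (η ++ [e']) = weight W η := by
  rw [weight_append, weight_append, weight_singleton, weight_singleton, ← mul_add, r_add_r W h,
    mul_one]

/-- The contribution of the vertex at which the two branches of `edgeDifference` split. -/
theorem pairing_edgeDifference_self (s : ℝ) {f : InfPath 2 → ℂ} (hf : f ∈ formDomain 2)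
    (η : FinPath 2) {e e' : Fin 2} (h : e ≠ e') :
    ((weight W η ^ (s - 2) : ℝ) : ℂ) *
      ∫ p, starRingEnd ℂ (f p.1 - f p.2) * (edgeDifference W η e e' p.1 -
        edgeDifference W η e e' p.2) ∂(choicePairMeasure W η) =
    ((1 / G W s η : ℝ) : ℂ) * (weight W η *
      ∫ x, starRingEnd ℂ (f x) * edgeDifference W η e e' x ∂(pathMeasure W)) := by
  have hA : (weight W (η ++ [e]) : ℂ) ≠ 0 := by exact_mod_cast (weight_pos W _).ne'
  have hB : (weight W (η ++ [e']) : ℂ) ≠ 0 := by exact_mod_cast (weight_pos W _).ne'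
  have hm := fun a : Fin 2 => measurableSet_cylinder (η ++ [a])
  rw [weight_rpow_mul_integral_pairing W s hf (edgeDifference_mem_formDomain _ _ _) η h,
    integral_conj_mul_edgeDifference hf,
    setIntegral_congr_fun (hm e) fun x hx => congrArg (starRingEnd ℂ (f x) * ·)
      (edgeDifference_of_mem_left h hx),
    setIntegral_congr_fun (hm e') fun x hx => congrArg (starRingEnd ℂ (f x) * ·)
      (edgeDifference_of_mem_right h hx),
    setIntegral_congr_fun (hm e) fun x hx => edgeDifference_of_mem_left (W := W) h hx,
    setIntegral_congr_fun (hm e') fun x hx => edgeDifference_of_mem_right (W := W) h hx,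
    integral_mul_const, integral_mul_const, setIntegral_const, setIntegral_const,
    pathMeasure_real_cylinderSet, pathMeasure_real_cylinderSet,
    -- With child masses `A`, `B` and integrals `I`, `J` of the conjugate of `f` over the children,
    -- what remains is `B * I / A - A * J / B + I - J = (A + B) * (I / A - J / B)`.
    ← weight_append_add_weight_append η h]
  simp only [Complex.real_smul]
  push_cast
  field_simp
  ring

/-- The contribution of a vertex passed on the way to the splitting. -/
theorem pairing_edgeDifference_take (s : ℝ) {f : InfPath 2 → ℂ} (hf : f ∈ formDomain 2)
    (η : FinPath 2) (e e' : Fin 2) {k : ℕ} (hk : k < η.length) :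
    ((weight W (η.take k) ^ (s - 2) : ℝ) : ℂ) *
      ∫ p, starRingEnd ℂ (f p.1 - f p.2) * (edgeDifference W η e e' p.1 -
        edgeDifference W η e e' p.2) ∂(choicePairMeasure W (η.take k)) =
    ((1 / G W s (η.take k) : ℝ) : ℂ) * ((weight W (η.take k) - weight W (η.take (k + 1)) : ℝ) *
      ∫ x, starRingEnd ℂ (f x) * edgeDifference W η e e' x ∂(pathMeasure W)) := by
  -- `a'` is the vertex that `η` does not follow at level `k`; `edgeDifference` vanishes on its
  -- branch.
  obtain ⟨a', ha⟩ := exists_ne η[k]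
  have htake : η.take k ++ [η[k]] = η.take (k + 1) := by simp
  have hsupp : ∀ x, x ∉ cylinderSet (η.take k ++ [η[k]]) → edgeDifference W η e e' x = 0 := by
    intro x hx
    refine edgeDifference_of_notMem fun h => hx ?_
    rw [htake]
    exact mem_cylinderSet_take h _
  have hzero : ∀ x ∈ cylinderSet (η.take k ++ [a']), edgeDifference W η e e' x = 0 := fun x hx =>
    hsupp x (Set.disjoint_left.1 (disjoint_cylinderSet_append_singleton _ ha) hx)
  have hm := measurableSet_cylinder (η.take k ++ [a'])
  have hw := weight_append_add_weight_append (W := W) (η.take k) ha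
  rw [htake] at hw
  -- Of the four terms, two vanish because `edgeDifference` is zero on the branch of `a'`, and one
  -- because its total integral is zero. The survivor carries the mass of that branch, `weight W
  -- (η.take k) - weight W (η.take (k + 1))`.
  rw [weight_rpow_mul_integral_pairing W s hf (edgeDifference_mem_formDomain _ _ _) _ ha.symm,
    setIntegral_eq_integral_of_forall_compl_eq_zero (f := edgeDifference W η e e') hsupp,
    setIntegral_eq_integral_of_forall_compl_eq_zero
      (f := fun x => starRingEnd ℂ (f x) * edgeDifference W η e e' x)
      (fun x hx => by rw [hsupp x hx, mul_zero]),
    setIntegral_congr_fun hm fun x hx => congrArg (starRingEnd ℂ (f x) * ·) (hzero x hx),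
    setIntegral_congr_fun hm hzero, integral_edgeDifference, ← eq_sub_of_add_eq hw]
  simp

theorem pairing_edgeDifference_eq_zero (f : InfPath 2 → ℂ) {η γ : FinPath 2} (e e' : Fin 2)
    (hlen : γ.length ≤ η.length) (hγ : γ ≠ η.take γ.length) :
    ∫ p, starRingEnd ℂ (f p.1 - f p.2) * (edgeDifference W η e e' p.1 -
        edgeDifference W η e e' p.2) ∂(choicePairMeasure W γ) = 0 := by
  have hzero : ∀ x ∈ cylinderSet γ, edgeDifference W η e e' x = 0 := fun x hx =>
    edgeDifference_of_notMem fun h => hγ (eq_take_of_mem_cylinderSet hx h hlen)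
  refine integral_eq_zero_of_ae ?_
  filter_upwards [ae_mem_cylinder W γ] with p hp
  simp [hzero _ hp.1, hzero _ hp.2]

/-- Only the blocks at the prefixes of `η` are nonzero, and each is a multiple of the same inner
product. The sign comes from `eigenvalueFormula` having the mass differences in the opposite order.
-/
theorem dirichletForm_edgeDifference (s : ℝ) {f : InfPath 2 → ℂ} (hf : f ∈ formDomain 2)
    (η : FinPath 2) {e e' : Fin 2} (h : e ≠ e') :
    dirichletForm W s f (edgeDifference W η e e') = -((eigenvalueFormula W s η : ℂ) *
      ∫ x, starRingEnd ℂ (f x) * edgeDifference W η e e' x ∂(pathMeasure W)) := by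
  -- `edgeDifference` depends on the first `η.length + 1` coordinates, so the blocks of length at
  -- most `η.length` remain, including the one at `η` itself.
  rw [dirichletForm_eq W s (edgeDifference_congr η e e') (edgeDifference_mem_formDomain _ _ _) hf]
  have hinj : Set.InjOn (fun k => η.take k) (Finset.range (η.length + 1) : Finset ℕ) := by
    intro a ha b hb hab
    simp only [Finset.coe_range, Set.mem_Iio] at ha hb
    have := congrArg List.length hab
    simp only [List.length_take] at this
    omega
  have hsub : (Finset.range (η.length + 1)).image (fun k => η.take k) ⊆
      (List.finite_length_lt (Fin 2) (η.length + 1)).toFinset := by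
    intro γ hγ
    obtain ⟨k, -, rfl⟩ := Finset.mem_image.1 hγ
    simp only [Set.Finite.mem_toFinset, Set.mem_ofPred_eq, List.length_take]
    omega
  rw [← Finset.sum_subset hsub, Finset.sum_image hinj, Finset.sum_range_succ, List.take_length,
    pairing_edgeDifference_self s hf η h, Finset.sum_congr rfl fun k hk =>
      pairing_edgeDifference_take s hf η e e' (Finset.mem_range.1 hk), eigenvalueFormula]
  · simp only [pathMeasure_real_cylinderSet]
    push_cast
    rw [sub_mul, Finset.sum_mul, neg_sub, sub_eq_add_neg, ← Finset.sum_neg_distrib, add_comm]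
    congr 1
    · ring
    · exact Finset.sum_congr rfl fun k _ => by ring
  · intro γ hγ hγ'
    have hlen : γ.length < η.length + 1 := by simpa using hγ
    rw [pairing_edgeDifference_eq_zero f e e' (Nat.lt_succ_iff.1 hlen), mul_zero]
    intro h'
    exact hγ' (Finset.mem_image.2 ⟨γ.length, Finset.mem_range.2 hlen, h'.symm⟩)

end

/-! ### The graph of the operator: density, single-valuedness, eigenvectors -/

section

/-- `dirichletForm_eq` truncates the sum at the resolution of the second argument; symmetry lets the
fixed function play that role while the other one varies. -/
theorem conj_dirichletForm {D : ℕ} [Nontrivial (Fin D)] (W : VertexWeights D) (s : ℝ)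
    (f g : InfPath D → ℂ) :
    starRingEnd ℂ (dirichletForm W s f g) = dirichletForm W s g f := by
  have h : ∀ f g : InfPath D → ℂ, dirichletForm W s f g = (1 / 2) * ∫ τ, ∑' γ,
      2 * ((weight W γ ^ (s - 2) : ℝ) : ℂ) *
        (starRingEnd ℂ (f (τ γ).1 - f (τ γ).2) * (g (τ γ).1 - g (τ γ).2))
        ∂(choiceMeasure W) := fun f g => by
    simp only [dirichletForm, blockTrace, trace_block]
  rw [h, h, map_mul, ← integral_conj]
  congr 1
  · rw [map_div₀, map_one, Complex.conj_ofNat]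
  · refine integral_congr_ae (Eventually.of_forall fun τ => ?_)
    simp only [Complex.conj_tsum]
    refine tsum_congr fun γ => ?_
    simp only [map_mul, map_sub, Complex.conj_conj, Complex.conj_ofReal, map_ofNat]
    ring

theorem isPiSystem_range_cylinderSet (D : ℕ) :
    IsPiSystem (Set.range (cylinderSet : FinPath D → Set (InfPath D))) := by
  rintro _ ⟨γ, rfl⟩ _ ⟨η, rfl⟩ ⟨x, hγ, hη⟩
  rcases le_total γ.length η.length with h | h
  · refine ⟨η, (Set.inter_eq_right.2 (cylinderSet_anti ?_)).symm⟩
    exact List.prefix_iff_eq_take.2 (eq_take_of_mem_cylinderSet hγ hη h)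
  · refine ⟨γ, (Set.inter_eq_left.2 (cylinderSet_anti ?_)).symm⟩
    exact List.prefix_iff_eq_take.2 (eq_take_of_mem_cylinderSet hη hγ h)

/-- Fixing one coordinate is a countable union of cylinders, taken over all possible initial words
up to that coordinate. -/
theorem measurableSpace_eq_generateFrom_cylinderSet (D : ℕ) :
    (MeasurableSpace.pi : MeasurableSpace (InfPath D)) =
      MeasurableSpace.generateFrom (Set.range cylinderSet) := by
  apply le_antisymm
  · refine iSup_le fun n => ?_
    rw [← measurable_iff_comap_le]
    refine @measurable_to_countable' _ _ _ _ (_) _ fun i => ?_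
    have : (fun x : InfPath D => x n) ⁻¹' {i} =
        ⋃ γ : {γ : FinPath D // γ.length = n}, cylinderSet (γ.1 ++ [i]) := by
      ext x
      simp only [Set.mem_preimage, Set.mem_singleton_iff, Set.mem_iUnion,
        mem_cylinderSet_append_singleton]
      constructor
      · rintro rfl
        exact ⟨⟨initialSegment x n, by simp⟩, by simp [mem_cylinderSet], by simp⟩
      · rintro ⟨⟨γ, rfl⟩, -, h⟩
        exact h
    rw [this]
    exact MeasurableSet.iUnion fun γ => MeasurableSpace.measurableSet_generateFrom ⟨_, rfl⟩
  · refine MeasurableSpace.generateFrom_le ?_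
    rintro _ ⟨γ, rfl⟩
    exact measurableSet_cylinder γ

/-- The form domain is dense: an `L²` function orthogonal to it vanishes. -/
theorem eq_zero_of_forall_integral_conj_mul_eq_zero {D : ℕ} (W : VertexWeights D) (H : PathL2 W)
    (h : ∀ f ∈ formDomain D, ∫ x, starRingEnd ℂ (f x) * H x ∂(pathMeasure W) = 0) : H = 0 := by
  have hint : Integrable H (pathMeasure W) := (Lp.memLp H).integrable one_le_two
  have hcyl : ∀ γ : FinPath D, ∫ x in cylinderSet γ, H x ∂(pathMeasure W) = 0 := fun γ => by
    rw [← h _ (Submodule.subset_span ⟨γ, rfl⟩), ← integral_indicator (measurableSet_cylinder γ)]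
    refine integral_congr_ae (Eventually.of_forall fun x => ?_)
    by_cases hx : x ∈ cylinderSet γ <;> simp [hx]
  -- The whole space is the cylinder of the empty path; its integral is needed to pass to
  -- complements.
  have huniv : ∫ x, H x ∂(pathMeasure W) = 0 := by simpa using hcyl []
  rw [Lp.eq_zero_iff_ae_eq_zero]
  refine hint.ae_eq_zero_of_forall_setIntegral_eq_zero fun A hA _ => ?_
  induction A, hA using MeasurableSpace.induction_on_inter
    (measurableSpace_eq_generateFrom_cylinderSet D) (isPiSystem_range_cylinderSet D) with
  | empty => simp
  | basic t ht =>
    obtain ⟨γ, rfl⟩ := ht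
    exact hcyl γ
  | compl t ht ih =>
    have := integral_add_compl ht hint
    rw [ih (measure_lt_top _ _), huniv, zero_add] at this
    exact this
  | iUnion f hd hm ih =>
    rw [integral_iUnion hm hd hint.integrableOn]
    simp [fun i => ih i (measure_lt_top _ _)]

/-- `f` is bounded and the measure is a probability measure, so the integral is at most a constant
times the `L¹` norm of `g n`, hence of its `L²` norm. -/
theorem tendsto_setIntegral_conj_mul {D : ℕ} (W : VertexWeights D) {g : ℕ → InfPath D → ℂ}
    (hg : ∀ n, g n ∈ formDomain D)
    (hL : Tendsto (fun n => eLpNorm (g n) 2 (pathMeasure W)) atTop (𝓝 0))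
    {f : InfPath D → ℂ} (hf : f ∈ formDomain D) (A : Set (InfPath D)) :
    Tendsto (fun n => ∫ x in A, starRingEnd ℂ (g n x) * f x ∂(pathMeasure W)) atTop (𝓝 0) := by
  obtain ⟨-, ⟨C, hC⟩, -⟩ := formDomain_props hf
  have hlim := ((ENNReal.tendsto_toReal ENNReal.zero_ne_top).comp hL).const_mul C
  rw [ENNReal.toReal_zero, mul_zero] at hlim
  refine squeeze_zero_norm (fun n => ?_) hlim
  have hgi := integrable_of_mem_formDomain W (hg n)
  have hgf := integrable_conj_mul_of_mem_formDomain W (hg n) hf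
  obtain ⟨hgm, ⟨C', hC'⟩, -⟩ := formDomain_props (hg n)
  obtain ⟨x₀⟩ : Nonempty (InfPath D) := (pathMeasure W).nonempty_of_neZero
  have hC0 : 0 ≤ C := (norm_nonneg _).trans (hC x₀)
  have hmem : MemLp (g n) 2 (pathMeasure W) :=
    MemLp.of_bound hgm.aestronglyMeasurable C' (Eventually.of_forall hC')
  calc ‖∫ x in A, starRingEnd ℂ (g n x) * f x ∂(pathMeasure W)‖
      ≤ ∫ x in A, ‖starRingEnd ℂ (g n x) * f x‖ ∂(pathMeasure W) :=
        norm_integral_le_integral_norm _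
    _ ≤ ∫ x, ‖starRingEnd ℂ (g n x) * f x‖ ∂(pathMeasure W) :=
        setIntegral_le_integral hgf.norm (Eventually.of_forall fun x => norm_nonneg _)
    _ ≤ ∫ x, C * ‖g n x‖ ∂(pathMeasure W) := by
        refine integral_mono hgf.norm (hgi.norm.const_mul C) fun x => ?_
        simp only [norm_mul, RCLike.norm_conj]
        rw [mul_comm]
        exact mul_le_mul_of_nonneg_right (hC x) (norm_nonneg _)
    _ = C * (eLpNorm (g n) 1 (pathMeasure W)).toReal := by
        rw [integral_const_mul, eLpNorm_one_eq_lintegral_enorm,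
          integral_norm_eq_lintegral_enorm hgm.aestronglyMeasurable]
    _ ≤ C * (eLpNorm (g n) 2 (pathMeasure W)).toReal :=
        mul_le_mul_of_nonneg_left (ENNReal.toReal_mono hmem.eLpNorm_ne_top
          (eLpNorm_le_eLpNorm_of_exponent_le one_le_two hgm.aestronglyMeasurable)) hC0

variable (W : VertexWeights 2)

/-- With the fixed `f` moved to the second slot, the number of blocks no longer depends on `n`, and
each block is built from integrals that tend to zero. -/
theorem tendsto_dirichletForm_zero (s : ℝ) {g : ℕ → InfPath 2 → ℂ}
    (hg : ∀ n, g n ∈ formDomain 2)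
    (hL : Tendsto (fun n => eLpNorm (g n) 2 (pathMeasure W)) atTop (𝓝 0))
    {f : InfPath 2 → ℂ} (hf : f ∈ formDomain 2) :
    Tendsto (fun n => dirichletForm W s f (g n)) atTop (𝓝 0) := by
  suffices h : Tendsto (fun n => dirichletForm W s (g n) f) atTop (𝓝 0) by
    have := (Complex.continuous_conj.tendsto 0).comp h
    simpa only [Function.comp_def, conj_dirichletForm, map_zero] using this
  obtain ⟨N, hN⟩ := (formDomain_props hf).2.2
  simp only [fun n => dirichletForm_eq W s hN hf (hg n)]
  have hsum : ∑ _γ ∈ (List.finite_length_lt (Fin 2) N).toFinset, (0 : ℂ) = 0 :=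
    Finset.sum_const_zero
  refine hsum ▸ tendsto_finsetSum _ fun γ _ => ?_
  simp only [fun n => weight_rpow_mul_integral_pairing W s (hg n) hf γ zero_ne_one]
  have h1 := fun A => tendsto_setIntegral_conj_mul W hg hL hf A
  have h2 : ∀ A, Tendsto (fun n => ∫ x in A, starRingEnd ℂ (g n x) ∂(pathMeasure W))
      atTop (𝓝 0) := fun A => by
    simpa using tendsto_setIntegral_conj_mul W hg hL one_mem_formDomain A
  have := (((((h1 (cylinderSet (γ ++ [0]))).const_mul (weight W (γ ++ [1]) : ℂ)).add
    ((h1 (cylinderSet (γ ++ [1]))).const_mul (weight W (γ ++ [0]) : ℂ))).sub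
    ((h2 (cylinderSet (γ ++ [0]))).mul_const
      (∫ x in cylinderSet (γ ++ [1]), f x ∂(pathMeasure W)))).sub
    ((h2 (cylinderSet (γ ++ [1]))).mul_const
      (∫ x in cylinderSet (γ ++ [0]), f x ∂(pathMeasure W)))).const_mul
    ((1 / CuntzLaplacian.G W s γ : ℝ) : ℂ)
  simpa only [mul_zero, zero_mul, add_zero, sub_zero] using this

/-- The graph is single-valued. -/
theorem snd_eq_zero_of_mem_laplaceGraph (s : ℝ) (P : PathL2 W × PathL2 W)
    (hP : P ∈ laplaceGraph W s) (h0 : P.1 = 0) : P.2 = 0 := by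
  obtain ⟨g, hg, hL, -, hF⟩ := hP
  have hL' : Tendsto (fun n => eLpNorm (g n) 2 (pathMeasure W)) atTop (𝓝 0) := by
    refine hL.congr fun n => eLpNorm_congr_ae ?_
    rw [h0]
    filter_upwards [Lp.coeFn_zero ℂ 2 (pathMeasure W)] with x hx
    simp
  refine eq_zero_of_forall_integral_conj_mul_eq_zero W _ fun f hf => ?_
  have := tendsto_nhds_unique (hF f hf) (tendsto_dirichletForm_zero W s hg hL' hf)
  simpa using this

/-- `Submodule.toLinearPMap` has the given submodule as its graph only when that submodule is
single-valued, which is where the preceding result enters. -/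
theorem hasEigenvalueOn_of_forall_mem_laplaceGraph (s : ℝ) {E : Submodule ℂ (PathL2 W)} {c : ℂ}
    (hE : E ≠ ⊥) (h : ∀ φ ∈ E, (φ, c • φ) ∈ laplaceGraph W s) :
    HasEigenvalueOn (laplaceBeltrami W s) E c := by
  refine ⟨hE, fun φ hφ => ?_⟩
  have hg := fun P hP => snd_eq_zero_of_mem_laplaceGraph W s P hP
  have hmem := h φ hφ
  rw [← Submodule.toLinearPMap_graph_eq _ hg, LinearPMap.mem_graph_iff] at hmem
  obtain ⟨⟨y, hy⟩, rfl, h2⟩ := hmem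
  exact ⟨hy, h2⟩

variable {W}

theorem coeFn_normalizedIndicator {D : ℕ} {W : VertexWeights D} (γ : FinPath D) :
    normalizedIndicator W γ =ᵐ[pathMeasure W]
      (weight W γ : ℂ)⁻¹ • (cylinderSet γ).indicator 1 := by
  rw [normalizedIndicator]
  filter_upwards [indicatorConstLp_coeFn (p := 2) (hs := measurableSet_cylinder γ)
    (hμs := measure_ne_top (pathMeasure W) _)
    (c := (((pathMeasure W).real (cylinderSet γ) : ℂ)⁻¹))] with x hx
  rw [hx, pathMeasure_real_cylinderSet]
  by_cases h : x ∈ cylinderSet γ <;> simp [h]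

theorem coeFn_normalizedIndicator_sub (η : FinPath 2) (e e' : Fin 2) :
    ⇑(normalizedIndicator W (η ++ [e]) - normalizedIndicator W (η ++ [e'])) =ᵐ[pathMeasure W]
      edgeDifference W η e e' := by
  filter_upwards [Lp.coeFn_sub (normalizedIndicator W (η ++ [e]))
    (normalizedIndicator W (η ++ [e'])), coeFn_normalizedIndicator (W := W) (η ++ [e]),
    coeFn_normalizedIndicator (W := W) (η ++ [e'])] with x h1 h2 h3
  rw [h1, Pi.sub_apply, h2, h3, edgeDifference, Pi.sub_apply]

/-- The function takes a nonzero constant value on `[ηe]`, which has positive measure. -/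
theorem normalizedIndicator_sub_ne_zero (η : FinPath 2) {e e' : Fin 2} (h : e ≠ e') :
    normalizedIndicator W (η ++ [e]) - normalizedIndicator W (η ++ [e']) ≠ 0 := by
  intro h0
  have hae := coeFn_normalizedIndicator_sub (W := W) η e e'
  rw [h0] at hae
  have hnull : pathMeasure W (cylinderSet (η ++ [e])) = 0 := by
    refine measure_mono_null (fun x hx => ?_) (ae_iff.1
      (hae.symm.trans (Lp.coeFn_zero ℂ 2 (pathMeasure W))))
    simpa [edgeDifference_of_mem_left h hx] using (weight_pos W _).ne'
  exact pathMeasure_cylinder_ne_zero W _ hnull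

/-- The representative `edgeDifference` lies in the form domain, so a constant sequence serves as
the approximating one and all limits are trivial. -/
theorem mem_laplaceGraph_normalizedIndicator_sub (s : ℝ) (η : FinPath 2) {e e' : Fin 2}
    (h : e ≠ e') :
    (normalizedIndicator W (η ++ [e]) - normalizedIndicator W (η ++ [e']),
      (eigenvalueFormula W s η : ℂ) •
        (normalizedIndicator W (η ++ [e]) - normalizedIndicator W (η ++ [e']))) ∈
      laplaceGraph W s := by
  have hae := coeFn_normalizedIndicator_sub (W := W) η e e'
  refine ⟨fun _ => edgeDifference W η e e', fun _ => edgeDifference_mem_formDomain _ _ _, ?_, ?_,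
    fun f hf => ?_⟩
  · have : eLpNorm (edgeDifference W η e e' - ⇑(normalizedIndicator W (η ++ [e]) -
        normalizedIndicator W (η ++ [e']))) 2 (pathMeasure W) = 0 := by
      rw [eLpNorm_congr_ae (g := (0 : InfPath 2 → ℂ)), eLpNorm_zero]
      filter_upwards [hae] with x hx
      rw [Pi.sub_apply, hx, sub_self, Pi.zero_apply]
    simp only [this, tendsto_const_nhds_iff]
  · have := norm_dirichletForm_smul W s 0 (zero_mem (formDomain 2))
    have h0 : dirichletForm W s 0 0 = 0 := by simpa using this
    simp only [sub_self, h0, tendsto_const_nhds_iff]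
  · simp only [dirichletForm_edgeDifference s hf η h, tendsto_const_nhds_iff]
    rw [← integral_const_mul]
    refine congrArg Neg.neg (integral_congr_ae ?_)
    filter_upwards [hae, Lp.coeFn_smul (eigenvalueFormula W s η : ℂ)
      (normalizedIndicator W (η ++ [e]) - normalizedIndicator W (η ++ [e']))] with x h1 h2
    rw [h2, Pi.smul_apply, h1, smul_eq_mul]
    ring

theorem hasEigenvalueOn_eigenSpan (s : ℝ) (η : FinPath 2) :
    HasEigenvalueOn (laplaceBeltrami W s) (eigenSpan W η) (eigenvalueFormula W s η : ℂ) := by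
  refine hasEigenvalueOn_of_forall_mem_laplaceGraph W s ?_ ?_
  · rw [Submodule.ne_bot_iff]
    exact ⟨_, Submodule.subset_span ⟨0, 1, zero_ne_one, rfl⟩,
      normalizedIndicator_sub_ne_zero η zero_ne_one⟩
  · have hle : eigenSpan W η ≤ (laplaceGraph W s).comap
        (LinearMap.prod LinearMap.id ((eigenvalueFormula W s η : ℂ) • LinearMap.id)) := by
      refine Submodule.span_le.2 ?_
      rintro _ ⟨e, e', h, rfl⟩
      exact mem_laplaceGraph_normalizedIndicator_sub s η h
    exact fun φ hφ => hle hφ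

end

end CuntzLaplacian

end

/-! ### Assembly and the explicit form of the eigenvalue -/

theorem mainTheorem8 (r : ℝ) (hr : r ∈ Set.Ioo (0 : ℝ) 1) (s : ℝ) :
    let W : VertexWeights 2 := twoVertexWeights r hr
    let μ : FinPath 2 → ℝ := fun γ => (pathMeasure W).real (cylinderSet γ)
    IsDixmierMeasure W (pathMeasure W) ∧
    (∀ ξ : FinPath 2, G W s ξ = μ ξ ^ (4 - s) * (r * (1 - r))) ∧
    ∀ (n : ℕ) (v : Fin (n + 1) → Fin 2),
      let η : FinPath 2 := List.ofFn v
      let lam : ℝ := (weight W [v 0] - 1) / (r * (1 - r)) +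
        (∑ k : Fin n, μ (η.take (k + 1)) ^ (s - 3) / (r * (1 - r)) * (weight W [v k.succ] - 1)) -
        μ η ^ (s - 3) / (r * (1 - r))
      HasEigenvalueOn (laplaceBeltrami W s) (eigenSpan W η) (lam : ℂ) ∧
      eigenvalueFormula W s η = lam := by
  intro W μ
  have hG : ∀ ξ : FinPath 2, G W s ξ = μ ξ ^ (4 - s) * (r * (1 - r)) := fun ξ => by
    rw [G_eq]
    simp [μ, pathMeasure_real_cylinderSet, W, twoVertexWeights]
  refine ⟨isDixmierMeasure_pathMeasure W, hG, ?_⟩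
  intro n v η lam
  have hlam : eigenvalueFormula W s η = lam := by
    have hμ : ∀ γ, μ γ = weight W γ := pathMeasure_real_cylinderSet W
    -- The exponent `s - 3` is `1 - (4 - s)`: one power of the mass divided by the power in `G`.
    have hdiv : ∀ γ : FinPath 2, weight W γ / G W s γ = μ γ ^ (s - 3) / (r * (1 - r)) := fun γ => by
      have hw := weight_pos W γ
      have h2 : weight W γ ^ (s - 3) = weight W γ / weight W γ ^ (4 - s) := by
        rw [eq_div_iff (Real.rpow_pos_of_pos hw _).ne', ← Real.rpow_add hw]
        ring_nf
        exact Real.rpow_one _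
      rw [hG, hμ, h2, div_div]
    have hlen : η.length = n + 1 := by simp [η]
    have hterm : ∀ k : Fin (n + 1), 1 / G W s (η.take k) *
        ((pathMeasure W).real (cylinderSet (η.take (k + 1))) -
          (pathMeasure W).real (cylinderSet (η.take k))) =
        μ (η.take k) ^ (s - 3) / (r * (1 - r)) * (weight W [v k] - 1) := fun k => by
      -- Appending `v k` multiplies the mass by its weight, so the mass difference factors as `μ
      -- (η.take k) * (weight W [v k] - 1)`.
      have htake : η.take (k + 1) = η.take k ++ [v k] := by
        rw [List.take_succ_eq_append_getElem (by omega)]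
        simp only [η, List.getElem_ofFn]
      rw [← hdiv, htake, pathMeasure_real_cylinderSet, pathMeasure_real_cylinderSet,
        weight_append]
      ring
    -- The term at index 0 belongs to the empty path, of mass 1, and becomes the separate first
    -- summand; the remaining `n` indices shift by one.
    rw [eigenvalueFormula, hlen, Finset.sum_range, Finset.sum_congr rfl fun k _ => hterm k,
      Fin.sum_univ_succ, pathMeasure_real_cylinderSet, hdiv]
    simp only [lam, Fin.val_zero, List.take_zero, Fin.val_succ]
    rw [hμ, weight_nil, Real.one_rpow, one_div_mul_eq_div]
  exact ⟨hlam ▸ hasEigenvalueOn_eigenSpan s η, hlam⟩
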